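/- Let $H$ be a finite-dimensional complex Hilbert space and let $(\psi_s)_{0\le s\le 1}$ be unit vectors of $H$ such that $\psi_s$ is an eigenvector of a unitary $U_s$, with non-degenerate eigenphase $\varphi_s$ (that is, $U_s\psi_s=e^{i\varphi_s}\psi_s$ and this eigenspace is spanned by $\psi_s$) at distance at least $\Delta>0$, modulo $2\pi$, from every other eigenphase of $U_s$. No continuity in $s$ is assumed. Suppose that phases $\tilde\varphi_s$ with $\tilde\varphi_s-\varphi_s\in[-\Delta/4,\Delta/4]$ (modulo $2\pi$) are known. A procedure may apply, at unit cost and controlled on ancilla qubits, the reflection oracles ${\rm R}(U_s,\tilde\varphi_s,\Delta)$; these are arbitrary isometries that commute with every operator commuting with $U_s$, preserve eigenvectors of $U_s$, and act on an eigenvector of eigenphase $\varphi$ as $-1$ if $|\varphi-\tilde\varphi_s|\le\Delta/4$ and as $+1$ if $|\varphi-\tilde\varphi_s|\ge 3\Delta/4$ (distances modulo $2\pi$). Its only other operations are unitaries and measurements on ancilla qubits and classical control, none of which depend on the path. Let $\theta=\arccos\sqrt{1/3}$, let $$L(s)=\sup\Big\{\sum_{j=1}^{n}\arccos|\langle\psi_{s_j},\psi_{s_{j-1}}\rangle|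 \;:\; 0=s_0<\dots<s_n=s\Big\},\qquad L=L(1)<\infty,$$ $v_{\rm avg}=L$, and $v_{\max}=\sup\{(L(s_2)-L(s_1))/(s_2-s_1): 0\le s_1<s_2\le 1,\ L(s_2)-L(s_1)>\theta\}$, assumed finite, with $v_{\max}=v_{\rm avg}$ if $L\le\theta$. Put $$\bar n=\frac{40\,L\,(\log_2(v_{\max}/v_{\rm avg})+3)}{\theta}+10$$ (so $\bar n=10$ if $L=0$). For states $\psi_a,\psi_b$, the procedure $T'_{mx}$ is the following. Attach a qubit in the state $\sqrt{3/4}\,|0\rangle+\sqrt{1/4}\,|1\rangle$, so that the source is $\tilde\psi=\psi_a\otimes(\sqrt{3/4}\,|0\rangle+\sqrt{1/4}\,|1\rangle)$ and the target is $\tilde\phi=\psi_b\otimes|0\rangle$. Measure $\tilde\phi$ (by a controlled reflection); while it has not been found, at most twice, reflect around $\tilde\psi$ and measure $\tilde\phi$ again. If it still has not been found, measure $\tilde\psi$ and $\tilde\phi$ alternately until one of them is found. The procedure succeeds if $\tilde\phi$ is found, and fails, giving back $\psi_a$, if $\tilde\psi$ is found. Consider the procedure that applies $T'_{mx}$ recursively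 on the binary interval tree of $[0,1]$: to get from $\psi_a$ to $\psi_b$, apply $T'_{mx}$, and if it fails go recursively from $\psi_a$ to $\psi_{(a+b)/2}$ and then to $\psi_b$. Started in $\psi_0$ on the interval $[0,1]$, it halts with probability $1$, and on halting the system is always in the state $\psi_1$. The number $n$ of reflections that it uses satisfies $$\langle n\rangle\le\bar n\qquad\text{and}\qquad\langle\Gamma^{n}\rangle\le\Gamma^{36\bar n}\quad\text{for all } 1\le\Gamma\le 14/13 .$$ -/

import Mathlib

open scoped ENNReal Kronecker

noncomputable section

namespace Eigenpath

/-! ### Angular length and angular velocities of a path of states -/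

/-- The angular distance `arccos |⟨ψ, φ⟩|` between two pure states. -/
def angDist {H : Type*} [NormedAddCommGroup H] [InnerProductSpace ℂ H] (x y : H) : ℝ :=
  Real.arccos ‖inner ℂ x y‖

/-- `arcLength ψ s` is `L(s)`, the angular length of the path `ψ` restricted to `[0, s]`: the
supremum over all partitions `0 = t 0 < t 1 < ⋯ < t n = s` of the sum of the angular distances
of consecutive states. -/
def arcLength {H : Type*} [NormedAddCommGroup H] [InnerProductSpace ℂ H]
    (ψ : ℝ → H) (s : ℝ) : ℝ≥0∞ :=
  sSup {l : ℝ≥0∞ | ∃ (n : ℕ) (t : Fin (n + 1) → ℝ), StrictMono t ∧ t 0 = 0 ∧ t (Fin.last n) = s ∧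
    l = ∑ j : Fin n, ENNReal.ofReal (angDist (ψ (t j.succ)) (ψ (t j.castSucc)))}

/-- The average angular velocities of the path over those parameter intervals in `[0, 1]` whose
angular length exceeds `θ`. -/
def speeds {H : Type*} [NormedAddCommGroup H] [InnerProductSpace ℂ H]
    (ψ : ℝ → H) (θ : ℝ) : Set ℝ :=
  {v : ℝ | ∃ s₁ s₂ : ℝ, 0 ≤ s₁ ∧ s₁ < s₂ ∧ s₂ ≤ 1 ∧
    θ < (arcLength ψ s₂).toReal - (arcLength ψ s₁).toReal ∧
    v = ((arcLength ψ s₂).toReal - (arcLength ψ s₁).toReal) / (s₂ - s₁)}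

/-- The average angular velocity `L / 1` over the whole path. -/
def vAvg {H : Type*} [NormedAddCommGroup H] [InnerProductSpace ℂ H] (ψ : ℝ → H) : ℝ :=
  ((arcLength ψ 1).toReal - (arcLength ψ 0).toReal) / (1 - 0)

open Classical in
/-- The maximum locally averaged angular velocity at scale `θ`. -/
def vMax {H : Type*} [NormedAddCommGroup H] [InnerProductSpace ℂ H] (ψ : ℝ → H) (θ : ℝ) : ℝ :=
  if (arcLength ψ 1).toReal ≤ θ then vAvg ψ else sSup (speeds ψ θ)

/-! ### Reflection oracles

An eigenphase is an element of `Real.Angle = ℝ / 2πℤ`; its norm is the distance to `0` modulo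
`2π`. -/

/-- `v` is in the eigenspace of the unitary `U` with eigenphase `φ`: `U v = exp(i φ) v`. -/
def HasPhase {H : Type*} [NormedAddCommGroup H] [InnerProductSpace ℂ H]
    (U : H ≃ₗᵢ[ℂ] H) (φ : Real.Angle) (v : H) : Prop :=
  U v = (φ.toCircle : ℂ) • v

/-- `R` realises the reflection oracle `R(U, φ₀, δ)`: an isometry which flips the sign of the
eigenvectors with eigenphase within `δ/4` of `φ₀`, fixes the eigenvectors whose eigenphase is at
distance at least `3δ/4` from `φ₀`, is otherwise only required to preserve eigenvectors, and
commutes with everything that commutes with `U`. (The oracle may correlate the phase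
of an eigenvector of the third kind with an environment. No eigenvectors of that kind exist
when `φ₀` is `δ/4`-close to an eigenphase separated by at least `δ` from all the others, so that no
environment is carried along here.) -/
structure IsReflectionOracle {H : Type*} [NormedAddCommGroup H] [InnerProductSpace ℂ H]
    (U : H ≃ₗᵢ[ℂ] H) (φ₀ : Real.Angle) (δ : ℝ) (R : H →ₗᵢ[ℂ] H) : Prop where
  near : ∀ (φ : Real.Angle) (v : H), HasPhase U φ v → ‖φ - φ₀‖ ≤ δ / 4 → R v = -v
  far : ∀ (φ : Real.Angle) (v : H), HasPhase U φ v → 3 * δ / 4 ≤ ‖φ - φ₀‖ → R v = v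
  preserves : ∀ (φ : Real.Angle) (v : H), HasPhase U φ v → ∃ c : ℂ, R v = c • v
  controlled : ∀ X : H →ₗ[ℂ] H, (∀ v, X (U v) = U (X v)) → ∀ v, X (R v) = R (X v)

/-! ### Procedures that use controlled reflections along a path

A procedure acts on the system and two ancilla qubits `A` (first index) and `C` (second index).
A vector of the joint space `H ⊗ ℂ² ⊗ ℂ²` is given by its four components in `H`. A procedure
has no access to the system other than through (controlled) reflections. -/

/-- Basis labels of the two ancilla qubits `A` and `C`. -/
abbrev Anc : Type := Fin 2 × Fin 2

/-- Elementary gates: a unitary on the ancillas, or a reflection, requested for the path parameter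
`s`, controlled on the ancillas being in one of the basis states in `ctrl`. -/
inductive Gate : Type where
  | ancilla (M : Matrix.unitaryGroup Anc ℂ)
  | reflection (s : ℝ) (ctrl : Finset Anc)

/-- The number of reflections used by a gate. -/
def Gate.cost : Gate → ℕ
  | .ancilla _ => 0
  | .reflection _ _ => 1

/-- The action of a gate on the joint space, when `R s` is the reflection applied at `s`. -/
def Gate.apply {H : Type*} [NormedAddCommGroup H] [InnerProductSpace ℂ H]
    (R : ℝ → H →ₗᵢ[ℂ] H) : Gate → (Anc → H) → (Anc → H)
  | .ancilla M, v => fun i => ∑ j, (M : Matrix Anc Anc ℂ) i j • v j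
  | .reflection s ctrl, v => fun i => if i ∈ ctrl then R s (v i) else v i

/-- A finite sequence of gates, the head of the list being applied first. -/
abbrev Circuit : Type := List Gate

/-- The number of reflections used by a circuit. -/
def Circuit.cost (c : Circuit) : ℕ := (c.map Gate.cost).sum

/-- The action of a circuit on the joint space. -/
def Circuit.apply {H : Type*} [NormedAddCommGroup H] [InnerProductSpace ℂ H]
    (R : ℝ → H →ₗᵢ[ℂ] H) (c : Circuit) (v : Anc → H) : Anc → H :=
  c.foldl (fun w g => g.apply R w) v

/-- The (unnormalised) effect of measuring the qubit `C` in the computational basis with outcome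
`o`, after which `C` is reset to `|0⟩`. -/
def collapse {H : Type*} [NormedAddCommGroup H] [InnerProductSpace ℂ H]
    (o : Fin 2) (v : Anc → H) : Anc → H :=
  fun i => if i.2 = 0 then v (i.1, o) else 0

/-- An adaptive procedure. In every round it runs a circuit that depends on its classical control
state, then measures and resets the qubit `C`; the outcome determines the next control
state. It halts in a control state `k` with `next k = none`. -/
structure Procedure : Type 1 where
  Ctrl : Type
  start : Ctrl
  next : Ctrl → Option (Circuit × (Fin 2 → Ctrl))

/-- A snapshot of a run: the control state, the unnormalised joint state (its squared norm is the
probability of the measurement outcomes obtained so far), and the number of reflections used. -/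
structure Snapshot (C : Type) (H : Type*) where
  ctrl : C
  vec : Anc → H
  used : ℕ

/-- The squared norm of a vector of the joint space. -/
def weight {H : Type*} [NormedAddCommGroup H] [InnerProductSpace ℂ H] (v : Anc → H) : ℝ :=
  ∑ i, ‖v i‖ ^ 2

/-- `P.runFrom R x h` is the final snapshot of the run of `P` that starts in `x` and obtains the
list `h` of measurement outcomes, provided the run halts exactly after these outcomes. -/
def Procedure.runFrom {H : Type*} [NormedAddCommGroup H] [InnerProductSpace ℂ H]
    (P : Procedure) (R : ℝ → H →ₗᵢ[ℂ] H) :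
    Snapshot P.Ctrl H → List (Fin 2) → Option (Snapshot P.Ctrl H)
  | x, [] =>
    match P.next x.ctrl with
    | none => some x
    | some _ => none
  | x, o :: h =>
    match P.next x.ctrl with
    | none => none
    | some (c, k) =>
      P.runFrom R ⟨k o, collapse o (c.apply R x.vec), x.used + c.cost⟩ h

/-- The joint state `x ⊗ |0⟩ ⊗ |0⟩`. -/
def withAncillas {H : Type*} [NormedAddCommGroup H] [InnerProductSpace ℂ H] (x : H) : Anc → H :=
  fun i => if i = (0, 0) then x else 0

/-- The halting run of `P` on input state `x` with outcomes `h`, if there is one. -/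
def Procedure.run {H : Type*} [NormedAddCommGroup H] [InnerProductSpace ℂ H]
    (P : Procedure) (R : ℝ → H →ₗᵢ[ℂ] H) (x : H) (h : List (Fin 2)) :
    Option (Snapshot P.Ctrl H) :=
  P.runFrom R ⟨P.start, withAncillas x, 0⟩ h

/-- The expectation of `f n` over all halting runs of `P` on input `x`, where `n` is the number of
reflections used. For `f = 1` it is the probability of halting. -/
def Procedure.expect {H : Type*} [NormedAddCommGroup H] [InnerProductSpace ℂ H]
    (P : Procedure) (R : ℝ → H →ₗᵢ[ℂ] H) (x : H) (f : ℕ → ℝ≥0∞) : ℝ≥0∞ :=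
  ∑' h : List (Fin 2),
    match P.run R x h with
    | none => 0
    | some y => ENNReal.ofReal (weight y.vec) * f y.used

/-! ### The procedure `T'_mx` -/

/-- The Hadamard matrix. -/
def hadamardMat : Matrix (Fin 2) (Fin 2) ℂ :=
  ((1 / √2 : ℝ) : ℂ) • !![1, 1; 1, -1]

/-- A self-inverse real unitary that maps `|0⟩` to `√(3/4) |0⟩ + √(1/4) |1⟩`. -/
def suppressMat : Matrix (Fin 2) (Fin 2) ℂ :=
  !![((√(3 / 4) : ℝ) : ℂ), ((√(1 / 4) : ℝ) : ℂ); ((√(1 / 4) : ℝ) : ℂ), -((√(3 / 4) : ℝ) : ℂ)]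

theorem hadamardMat_mem : hadamardMat ∈ Matrix.unitaryGroup (Fin 2) ℂ := by
  have h : ((√2 : ℝ) : ℂ) * ((√2 : ℝ) : ℂ) = 2 := by
    rw [← Complex.ofReal_mul, Real.mul_self_sqrt (by norm_num)]; norm_num
  have h' : (((√2 : ℝ) : ℂ))⁻¹ * (((√2 : ℝ) : ℂ))⁻¹ = 1 / 2 := by
    rw [← mul_inv, h]; norm_num
  rw [Matrix.mem_unitaryGroup_iff]
  ext i j
  fin_cases i <;> fin_cases j <;>
    simp [hadamardMat, Matrix.mul_apply, Fin.sum_univ_two, Matrix.star_apply, h'] <;> norm_num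

theorem suppressMat_mem : suppressMat ∈ Matrix.unitaryGroup (Fin 2) ℂ := by
  have h3 : ((√(3 / 4) : ℝ) : ℂ) * ((√(3 / 4) : ℝ) : ℂ) = 3 / 4 := by
    rw [← Complex.ofReal_mul, Real.mul_self_sqrt (by norm_num)]; norm_num
  have h1 : ((√(1 / 4) : ℝ) : ℂ) * ((√(1 / 4) : ℝ) : ℂ) = 1 / 4 := by
    rw [← Complex.ofReal_mul, Real.mul_self_sqrt (by norm_num)]; norm_num
  rw [Matrix.mem_unitaryGroup_iff]
  ext i j
  fin_cases i <;> fin_cases j <;>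
    simp only [suppressMat, Matrix.mul_apply, Fin.sum_univ_two, Matrix.star_apply,
      Matrix.of_apply, Matrix.cons_val', Matrix.cons_val_zero, Matrix.cons_val_one,
      Matrix.cons_val_fin_one, Fin.zero_eta, Fin.mk_one, Matrix.one_apply_eq, Complex.star_def,
      map_neg, Complex.conj_ofReal] <;>
    first
      | linear_combination h3 + h1
      | (rw [Matrix.one_apply_ne (by decide)]; ring)

/-- The Hadamard gate on the qubit `C`. -/
def hadamardC : Gate :=
  .ancilla ⟨(1 : Matrix (Fin 2) (Fin 2) ℂ) ⊗ₖ hadamardMat,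
    Matrix.kronecker_mem_unitary (one_mem _) hadamardMat_mem⟩

/-- The overlap-suppression gate on the qubit `A`; it maps `|0⟩` to `√(3/4) |0⟩ + √(1/4) |1⟩` and is
its own inverse. -/
def suppressA : Gate :=
  .ancilla ⟨suppressMat ⊗ₖ (1 : Matrix (Fin 2) (Fin 2) ℂ),
    Matrix.kronecker_mem_unitary suppressMat_mem (one_mem _)⟩

/-- The reflection around the overlap-suppressed source state
`ψ_a ⊗ (√(3/4) |0⟩ + √(1/4) |1⟩)`. -/
def reflectSource (a : ℝ) : Circuit :=
  [suppressA, .reflection a {(0, 0), (0, 1)}, suppressA]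

/-- Followed by the measurement of `C` that ends a round, this is the measurement of the target state
`ψ_b ⊗ |0⟩` by a controlled reflection; the outcome `1` projects onto it, the
outcome `0` onto its orthogonal complement. -/
def testTarget (b : ℝ) : Circuit :=
  [hadamardC, .reflection b {(0, 1)}, hadamardC]

/-- Followed by the measurement of `C` that ends a round, this is the measurement of the
overlap-suppressed source state by a controlled reflection. -/
def testSource (a : ℝ) : Circuit :=
  [suppressA, hadamardC, .reflection a {(0, 1)}, hadamardC, suppressA]

/-- The stages of `T'_mx`. -/
inductive Stage : Type where
  | first | second | third | source | target | restore

/-- One round of `T'_mx` for the pair `ψ_a`, `ψ_b`: the circuit of the round, and, as a function of the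
measurement outcome, the next stage or the final result (`true` if the state has been
transformed into `ψ_b`, `false` if it has been returned to `ψ_a`).

The qubit `A` is prepared and the target is measured; at most two attempts of reflecting around the
source and measuring the target follow. If they all fail, source and target are measured
alternately until one of them is found. When it is the source, `A` is returned to `|0⟩`. -/
def tmxRound (a b : ℝ) : Stage → Circuit × (Fin 2 → Stage ⊕ Bool)
  | .first => (suppressA :: testTarget b, fun o => if o = 1 then .inr true else .inl .second)
  | .second =>
    (reflectSource a ++ testTarget b, fun o => if o = 1 then .inr true else .inl .third)
  | .third =>
    (reflectSource a ++ testTarget b, fun o => if o = 1 then .inr true else .inl .source)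
  | .source => (testSource a, fun o => if o = 1 then .inl .restore else .inl .target)
  | .target => (testTarget b, fun o => if o = 1 then .inr true else .inl .source)
  | .restore => ([suppressA], fun _ => .inr false)

/-! ### Recursion over the binary interval tree -/

/-- The procedure that applies `T'_mx` recursively on the binary interval tree of `[0, 1]`. The
control state holds the stage of the current instance of `T'_mx` and the list of the intervals that
remain to be traversed, the current one first. When the current interval has been
traversed successfully it is removed; when the attempt failed it is replaced by its two halves. -/
def treeTraversal : Procedure where
  Ctrl := Stage × List (ℝ × ℝ)
  start := (.first, [(0, 1)])
  next
    | (_, []) => none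
    | (q, (a, b) :: rest) =>
      some ((tmxRound a b q).1, fun o =>
        match (tmxRound a b q).2 o with
        | .inl q' => (q', (a, b) :: rest)
        | .inr true => (.first, rest)
        | .inr false => (.first, (a, (a + b) / 2) :: ((a + b) / 2, b) :: rest))

end Eigenpath

end

noncomputable section

namespace Eigenpath

variable {H : Type*} [NormedAddCommGroup H] [InnerProductSpace ℂ H]

/-! ### The reflection oracles are reflections -/

/-! The gap makes every oracle an exact reflection `v - 2⟨ψ, v⟩ψ`: eigenvectors span `H`, and all
phases other than `φ` lie at distance at least `3Δ/4` from the estimate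
(`IsReflectionOracle.apply_eq`). Hence one instance of `T'_mx` never leaves the span of its source
and target, apart from the disentangled final states. Up to a scalar its state is one of finitely
many explicit vectors (`collapse_round`), and the instance is a small Markov chain whose transition
weights depend only on the squared overlap `p ≤ 3/4`.

The number of reflections is controlled through its generating function at `Γ₀ = 14/13`. If the
recursion after a failure contributes a factor `h ≥ 1`, an attempt contributes at most `4h` for any
`p` (`stageGen_first_le`). If `p ≥ 1/4`, the value `h = 2 * 2` returns at most `2`
(`stageGen_first_le_two`). Since `3/4 * cos² θ = 1/4`, the latter applies to every interval of
angular length at most `θ`, and to all its subintervals: the bound `2` reproduces itself, although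
the recursion has unbounded depth. An interval cut by `N` bisections into such pieces gets the bound
`4^N * 2^(N+1) = 2 * 8^N`, which is at most `Γ₀^(40N+10)`.

These bounds form a supersolution of the recursion (`isSupersolution_reach`), so they dominate all
truncated expectations and, in the limit, the expectation itself. As reflections keep being used,
Markov's inequality applied to the generating function also gives almost sure halting.

It remains to count bisections (`exists_intervalBound`). With `x` the length in units of `θ` and `y`
its upper bound from the maximal velocity, `N + 1 ≤ x (log₂(y/x) + 3)` follows by induction from the
concavity of `x ↦ x log₂(y/x)`. So `⟨Γ₀^n⟩ ≤ Γ₀^nbar`, and Jensen's inequality yields the mean and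
all smaller `Γ`. -/

theorem HasPhase.inner_map_eq_zero {U : H ≃ₗᵢ[ℂ] H} {φ : Real.Angle} {w v : H}
    (hw : HasPhase U φ w) (h : inner ℂ w v = 0) : inner ℂ w (U v) = 0 := by
  have h1 : inner ℂ (U w) (U v) = 0 := by rw [U.inner_map_map, h]
  rw [hw, inner_smul_left] at h1
  exact (mul_eq_zero.1 h1).resolve_left (by simp)

theorem HasPhase.inner_eq_zero {U : H ≃ₗᵢ[ℂ] H} {φ μ : Real.Angle} {w v : H}
    (hw : HasPhase U φ w) (hv : HasPhase U μ v) (hne : μ ≠ φ) : inner ℂ w v = 0 := by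
  have h1 : inner ℂ (U w) (U v) = inner ℂ w v := U.inner_map_map w v
  rw [hw, hv, inner_smul_left, inner_smul_right, ← mul_assoc] at h1
  by_contra h0
  have h2 := mul_right_cancel₀ h0 (h1.trans (one_mul _).symm)
  -- On the unit circle conjugation is inversion, so a nonzero inner product would force equal
  -- phases.
  rw [← Circle.coe_inv_eq_conj, ← Circle.coe_mul, ← Circle.coe_one, Circle.coe_inj] at h2
  exact hne (by rw [← μ.arg_toCircle, ← φ.arg_toCircle, inv_mul_eq_one.1 h2])

theorem exists_hasPhase_of_eigenvector {U : H ≃ₗᵢ[ℂ] H} {c : ℂ} {v : H} (hv : v ≠ 0)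
    (h : U v = c • v) : ∃ φ, HasPhase U φ v := by
  have h1 : ‖c‖ = 1 := by
    have h2 : ‖U v‖ = ‖v‖ := U.norm_map v
    rw [h, norm_smul] at h2
    exact mul_right_cancel₀ (norm_ne_zero_iff.2 hv) (h2.trans (one_mul _).symm)
  refine ⟨(Complex.arg c : ℝ), ?_⟩
  have h2 : (((Complex.arg c : ℝ) : Real.Angle).toCircle : ℂ) = c := by
    rw [Real.Angle.toCircle_coe, Circle.coe_exp]
    conv_rhs => rw [← Complex.norm_mul_exp_arg_mul_I c, h1]
    simp
  rw [HasPhase, h2, h]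

/-- The eigenvectors of a unitary of a finite-dimensional space span the space. -/
theorem span_hasPhase_eq_top [FiniteDimensional ℂ H] (U : H ≃ₗᵢ[ℂ] H) :
    Submodule.span ℂ {v | ∃ φ, HasPhase U φ v} = ⊤ := by
  set W := Submodule.span ℂ {v | ∃ φ, HasPhase U φ v} with hW
  rw [← Submodule.orthogonal_eq_bot_iff]
  by_contra hne
  -- Invariance of the complement lets `U` be restricted to it; a nonzero complement would then
  -- contain an eigenvector, which lies in `W` by definition.
  have hinv : ∀ v ∈ Wᗮ, U.toLinearEquiv.toLinearMap v ∈ Wᗮ := by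
    intro v hv
    rw [Submodule.mem_orthogonal]
    intro w hw
    induction hw using Submodule.span_induction with
    | mem w hw =>
      obtain ⟨φ, hφ⟩ := hw
      exact hφ.inner_map_eq_zero
        ((Submodule.mem_orthogonal _ _).1 hv w (Submodule.subset_span ⟨φ, hφ⟩))
    | zero => exact inner_zero_left _
    | add x y _ _ hx hy => rw [inner_add_left, hx, hy, add_zero]
    | smul a x _ hx => rw [inner_smul_left, hx, mul_zero]
  have : Nontrivial Wᗮ := Submodule.nontrivial_iff_ne_bot.2 hne
  obtain ⟨c, hc⟩ := Module.End.exists_eigenvalue (U.toLinearEquiv.toLinearMap.restrict hinv)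
  obtain ⟨v, hv⟩ := hc.exists_hasEigenvector
  have hv0 : (v : H) ≠ 0 := fun h => hv.2 (Subtype.ext h)
  have hUv : U (v : H) = c • (v : H) := congrArg Subtype.val hv.apply_eq_smul
  obtain ⟨φ, hφ⟩ := exists_hasPhase_of_eigenvector hv0 hUv
  have hmem : (v : H) ∈ W := Submodule.subset_span ⟨φ, hφ⟩
  exact hv0 (inner_self_eq_zero.1 ((Submodule.mem_orthogonal _ _).1 v.2 v hmem))

/-- For a non-degenerate eigenphase `φ` separated by `δ` from the others, the oracle requested at a
phase `δ/4`-close to `φ` is the reflection around the eigenvector. -/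
theorem IsReflectionOracle.apply_eq [FiniteDimensional ℂ H] {U : H ≃ₗᵢ[ℂ] H}
    {φ φ₀ : Real.Angle} {δ : ℝ} {x : H} {R : H →ₗᵢ[ℂ] H} (hR : IsReflectionOracle U φ₀ δ R)
    (hx : ‖x‖ = 1) (hphase : HasPhase U φ x)
    (hnondeg : ∀ v : H, HasPhase U φ v → ∃ c : ℂ, v = c • x)
    (hgap : ∀ (μ : Real.Angle) (v : H), v ≠ 0 → HasPhase U μ v → μ ≠ φ → δ ≤ ‖μ - φ‖)
    (hest : ‖φ₀ - φ‖ ≤ δ / 4) (v : H) : R v = v - (2 * inner ℂ x v) • x := by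
  have hv : v ∈ Submodule.span ℂ {v | ∃ φ, HasPhase U φ v} := by
    rw [span_hasPhase_eq_top]; trivial
  induction hv using Submodule.span_induction with
  | mem v hv =>
    obtain ⟨μ, hμ⟩ := hv
    rcases eq_or_ne v 0 with rfl | hv0
    · simp
    by_cases h : μ = φ
    · subst h
      obtain ⟨c, rfl⟩ := hnondeg v hμ
      rw [hR.near μ _ hμ (by rwa [norm_sub_rev]), inner_smul_right,
        inner_self_eq_norm_sq_to_K, hx]
      simp only [Complex.coe_algebraMap, Complex.ofReal_one]
      module
    · rw [hphase.inner_eq_zero hμ h, hR.far μ v hμ]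
      · simp
      -- The triangle inequality leaves `δ - δ/4 = 3δ/4`, exactly the threshold of `far`.
      · have h1 := hgap μ v hv0 hμ h
        have h2 := norm_sub_le_norm_sub_add_norm_sub μ φ₀ φ
        linarith
  | zero => simp
  | add v w _ _ hv hw => rw [map_add, hv, hw, inner_add_right]; module
  | smul c v _ hv => rw [map_smul, hv, inner_smul_right]; module

/-! ### Expectations of procedures -/

theorem tsum_list_eq_nil_add {α : Type*} [Fintype α] (g : List α → ℝ≥0∞) :
    ∑' h, g h = g [] + ∑ o, ∑' h, g (o :: h) := by
  let e : Unit ⊕ (α × List α) ≃ List α :=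
    { toFun := Sum.elim (fun _ => []) (fun p => p.1 :: p.2)
      invFun := fun l => match l with
        | [] => .inl ()
        | o :: h => .inr (o, h)
      left_inv := by rintro (_ | _) <;> rfl
      right_inv := by rintro (_ | _) <;> rfl }
  rw [← e.tsum_eq, Summable.tsum_sum ENNReal.summable ENNReal.summable, tsum_fintype,
    ENNReal.tsum_prod', tsum_fintype]
  simp [e]

theorem weight_nonneg (v : Anc → H) : 0 ≤ weight v := Finset.sum_nonneg fun _ _ => sq_nonneg _

/-- The snapshot after a round with circuit `c` and outcome `o`. -/
def Snapshot.step {C : Type} (R : ℝ → H →ₗᵢ[ℂ] H) (x : Snapshot C H) (c : Circuit) (k : Fin 2 → C)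
    (o : Fin 2) : Snapshot C H :=
  ⟨k o, collapse o (c.apply R x.vec), x.used + c.cost⟩

namespace Procedure

variable (P : Procedure) (R : ℝ → H →ₗᵢ[ℂ] H)

/-- The contribution of the outcomes `h` to the expectation of `f` for the run from `x`. -/
def contribution (f : ℕ → ℝ≥0∞) (x : Snapshot P.Ctrl H) (h : List (Fin 2)) : ℝ≥0∞ :=
  match P.runFrom R x h with
  | none => 0
  | some y => ENNReal.ofReal (weight y.vec) * f y.used

/-- The expectation of `f` over the runs from `x` that halt within fewer than `N` rounds. -/
def truncExpect (f : ℕ → ℝ) : ℕ → Snapshot P.Ctrl H → ℝ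
  | 0, _ => 0
  | N + 1, x =>
    match P.next x.ctrl with
    | none => weight x.vec * f x.used
    | some (c, k) => ∑ o, truncExpect f N (x.step R c k o)

variable {P R}

theorem truncExpect_of_none {f : ℕ → ℝ} {x : Snapshot P.Ctrl H} (hx : P.next x.ctrl = none)
    (N : ℕ) : P.truncExpect R f (N + 1) x = weight x.vec * f x.used := by
  rw [truncExpect, hx]

theorem truncExpect_of_some {f : ℕ → ℝ} {x : Snapshot P.Ctrl H} {c : Circuit} {k : Fin 2 → P.Ctrl}
    (hx : P.next x.ctrl = some (c, k)) (N : ℕ) :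
    P.truncExpect R f (N + 1) x = ∑ o, P.truncExpect R f N (x.step R c k o) := by
  rw [truncExpect, hx]

theorem truncExpect_nonneg {f : ℕ → ℝ} (hf : ∀ n, 0 ≤ f n) (N : ℕ) (x : Snapshot P.Ctrl H) :
    0 ≤ P.truncExpect R f N x := by
  induction N generalizing x with
  | zero => exact le_rfl
  | succ N ih =>
    rcases hx : P.next x.ctrl with _ | ⟨c, k⟩
    · rw [truncExpect_of_none hx]
      exact mul_nonneg (weight_nonneg _) (hf _)
    · rw [truncExpect_of_some hx]
      exact Finset.sum_nonneg fun o _ => ih _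

theorem tsum_contribution_eq_truncExpect {f : ℕ → ℝ} (hf : ∀ n, 0 ≤ f n) (N : ℕ)
    (x : Snapshot P.Ctrl H) :
    ∑' h, (if h.length < N then P.contribution R (fun n => ENNReal.ofReal (f n)) x h else 0) =
      ENNReal.ofReal (P.truncExpect R f N x) := by
  induction N generalizing x with
  | zero => simp [truncExpect]
  | succ N ih =>
    rw [tsum_list_eq_nil_add]
    rcases hx : P.next x.ctrl with _ | ⟨c, k⟩
    · rw [truncExpect_of_none hx, ENNReal.ofReal_mul (weight_nonneg _)]
      simp [contribution, runFrom, hx]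
    · rw [truncExpect_of_some hx, ENNReal.ofReal_sum_of_nonneg fun o _ => truncExpect_nonneg hf _ _]
      simp only [← ih]
      simp [contribution, runFrom, hx, Snapshot.step]

theorem expect_eq_tsum_contribution (x : H) (f : ℕ → ℝ≥0∞) :
    P.expect R x f = ∑' h, P.contribution R f ⟨P.start, withAncillas x, 0⟩ h := rfl

theorem ofReal_truncExpect_le_expect {f : ℕ → ℝ} (hf : ∀ n, 0 ≤ f n) (N : ℕ) (x : H) :
    ENNReal.ofReal (P.truncExpect R f N ⟨P.start, withAncillas x, 0⟩) ≤
      P.expect R x fun n => ENNReal.ofReal (f n) := by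
  rw [← tsum_contribution_eq_truncExpect hf, expect_eq_tsum_contribution]
  refine ENNReal.tsum_le_tsum fun h => ?_
  split_ifs
  exacts [le_rfl, zero_le]

theorem expect_le_of_truncExpect_le {f : ℕ → ℝ} (hf : ∀ n, 0 ≤ f n) {x : H} {v : ℝ}
    (h : ∀ N, P.truncExpect R f N ⟨P.start, withAncillas x, 0⟩ ≤ v) :
    P.expect R x (fun n => ENNReal.ofReal (f n)) ≤ ENNReal.ofReal v := by
  rw [expect_eq_tsum_contribution, ENNReal.tsum_eq_iSup_sum]
  refine iSup_le fun s => ?_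
  -- Finitely many outcome lists have bounded length, so one truncation covers them all.
  set N := s.sup List.length + 1 with hN
  refine le_trans ?_ (ENNReal.ofReal_le_ofReal (h N))
  rw [← tsum_contribution_eq_truncExpect hf]
  refine le_trans (Finset.sum_le_sum fun l hl => ?_) (ENNReal.sum_le_tsum s)
  rw [if_pos (Nat.lt_succ_of_le (Finset.le_sup hl))]

theorem expect_mono (x : H) {f g : ℕ → ℝ≥0∞} (h : ∀ n, f n ≤ g n) :
    P.expect R x f ≤ P.expect R x g := by
  refine ENNReal.tsum_le_tsum fun l => ?_
  split
  · exact le_rfl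
  · gcongr
    exact h _

theorem expect_add (x : H) (f g : ℕ → ℝ≥0∞) :
    P.expect R x (fun n => f n + g n) = P.expect R x f + P.expect R x g := by
  rw [expect, expect, expect, ← ENNReal.tsum_add]
  refine tsum_congr fun l => ?_
  split
  · simp
  · rw [mul_add]

theorem expect_const_mul (x : H) (c : ℝ≥0∞) (f : ℕ → ℝ≥0∞) :
    P.expect R x (fun n => c * f n) = c * P.expect R x f := by
  rw [expect, expect, ← ENNReal.tsum_mul_left]
  refine tsum_congr fun l => ?_
  split
  · simp
  · ring

/-- A tangent-line form of Jensen's inequality for a procedure that halts almost surely: if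
`f ≤ a + b (g - m)` pointwise and `g` has mean at most `m`, then `f` has mean at most `a`. -/
theorem expect_le_of_tangent {x : H} (hone : P.expect R x (fun _ => 1) = 1) {f g : ℕ → ℝ}
    (hf : ∀ n, 0 ≤ f n) (hg : ∀ n, 0 ≤ g n) {a b m : ℝ} (ha : 0 ≤ a) (hb : 0 ≤ b) (hm : 0 ≤ m)
    (h : ∀ n, f n + b * m ≤ a + b * g n)
    (hmean : P.expect R x (fun n => ENNReal.ofReal (g n)) ≤ ENNReal.ofReal m) :
    P.expect R x (fun n => ENNReal.ofReal (f n)) ≤ ENNReal.ofReal a := by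
  have hc (c : ℝ) : P.expect R x (fun _ => ENNReal.ofReal c) = ENNReal.ofReal c := by
    simpa [hone] using expect_const_mul (P := P) (R := R) x (ENNReal.ofReal c) fun _ => 1
  have h1 : P.expect R x (fun n => ENNReal.ofReal (f n) + ENNReal.ofReal (b * m)) ≤
      P.expect R x (fun n => ENNReal.ofReal a + ENNReal.ofReal b * ENNReal.ofReal (g n)) := by
    refine expect_mono x fun n => ?_
    rw [← ENNReal.ofReal_mul hb, ← ENNReal.ofReal_add (hf n) (mul_nonneg hb hm),
      ← ENNReal.ofReal_add ha (mul_nonneg hb (hg n))]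
    exact ENNReal.ofReal_le_ofReal (h n)
  rw [expect_add, expect_add, hc, hc, expect_const_mul] at h1
  refine (ENNReal.add_le_add_iff_right (a := ENNReal.ofReal (b * m)) ENNReal.ofReal_ne_top).1
    (h1.trans ?_)
  rw [ENNReal.ofReal_mul hb]
  gcongr

/-! ### Supersolutions -/

/-- A family of snapshots `x` with weight `w` and a bound `v` for the generating function at `Γ` of
the number of reflections. Every second round of a run uses a reflection, which `lag` keeps track
of. -/
structure IsSupersolution (P : Procedure) (R : ℝ → H →ₗᵢ[ℂ] H) (Γ : ℝ) (lag : P.Ctrl → ℕ)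
    (B : Snapshot P.Ctrl H → ℝ → ℝ → Prop) : Prop where
  nonneg : ∀ {x w v}, B x w v → 0 ≤ w
  le : ∀ {x w v}, B x w v → w * Γ ^ x.used ≤ v
  halt : ∀ {x w v}, B x w v → P.next x.ctrl = none → weight x.vec = w
  lag_le : ∀ q, lag q ≤ 1
  step : ∀ {x w v c k}, B x w v → P.next x.ctrl = some (c, k) → ∃ w' v' : Fin 2 → ℝ,
    ∑ o, w' o = w ∧ ∑ o, v' o ≤ v ∧ ∀ o, B (x.step R c k o) (w' o) (v' o) ∧
      2 * x.used + lag x.ctrl + 1 ≤ 2 * (x.step R c k o).used + lag (k o)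

namespace IsSupersolution

variable {Γ : ℝ} {lag : P.Ctrl → ℕ} {B : Snapshot P.Ctrl H → ℝ → ℝ → Prop}

/-- Truncation assigns `0` to unfinished runs, which lies below any nonnegative bound; the one-step
inequality then propagates through the rounds. No fixed point or termination argument is needed. -/
theorem truncExpect_pow_le (hB : IsSupersolution P R Γ lag B) (hΓ : 1 ≤ Γ) (N : ℕ)
    {x : Snapshot P.Ctrl H} {w v : ℝ} (hx : B x w v) :
    P.truncExpect R (fun n => Γ ^ n) N x ≤ v := by
  induction N generalizing x w v with
  | zero => exact (mul_nonneg (hB.nonneg hx) (by positivity)).trans (hB.le hx)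
  | succ N ih =>
    rcases hn : P.next x.ctrl with _ | ⟨c, k⟩
    · rw [truncExpect_of_none hn, hB.halt hx hn]
      exact hB.le hx
    · obtain ⟨w', v', -, h2, h3⟩ := hB.step hx hn
      rw [truncExpect_of_some hn]
      exact (Finset.sum_le_sum fun o _ => ih (h3 o).1).trans h2

theorem truncExpect_one_le (hB : IsSupersolution P R Γ lag B) (N : ℕ) {x : Snapshot P.Ctrl H}
    {w v : ℝ} (hx : B x w v) : P.truncExpect R (fun _ => 1) N x ≤ w := by
  induction N generalizing x w v with
  | zero => exact hB.nonneg hx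
  | succ N ih =>
    rcases hn : P.next x.ctrl with _ | ⟨c, k⟩
    · rw [truncExpect_of_none hn, hB.halt hx hn, mul_one]
    · obtain ⟨w', v', h1, -, h3⟩ := hB.step hx hn
      rw [truncExpect_of_some hn, ← h1]
      exact Finset.sum_le_sum fun o _ => ih (h3 o).1

/-- Markov's inequality: a run still active after `N` rounds has used at least `m` reflections, so
the unfinished weight is at most `v / Γ ^ m`. -/
theorem le_truncExpect_one_add (hB : IsSupersolution P R Γ lag B) (hΓ : 1 ≤ Γ) {m : ℕ} (N : ℕ)
    {x : Snapshot P.Ctrl H} {w v : ℝ} (hx : B x w v) (hm : 2 * m ≤ N + 2 * x.used + lag x.ctrl) :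
    w ≤ P.truncExpect R (fun _ => 1) N x + v / Γ ^ m := by
  have hpos : 0 < Γ ^ m := by positivity
  induction N generalizing x w v with
  | zero =>
    have h1 := hB.lag_le x.ctrl
    -- The lag is at most `1`, so parity absorbs it.
    have h2 : m ≤ x.used := by omega
    rw [truncExpect, zero_add, le_div_iff₀ hpos]
    exact (mul_le_mul_of_nonneg_left (pow_le_pow_right₀ hΓ h2) (hB.nonneg hx)).trans (hB.le hx)
  | succ N ih =>
    rcases hn : P.next x.ctrl with _ | ⟨c, k⟩
    · rw [truncExpect_of_none hn, hB.halt hx hn, mul_one, le_add_iff_nonneg_right]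
      exact div_nonneg ((mul_nonneg (hB.nonneg hx) (by positivity)).trans (hB.le hx)) hpos.le
    · obtain ⟨w', v', h1, h2, h3⟩ := hB.step hx hn
      rw [truncExpect_of_some hn, ← h1]
      refine (Finset.sum_le_sum fun o _ => ih (h3 o).1 ?_).trans ?_
      · have h4 := (h3 o).2
        have h5 : (x.step R c k o).ctrl = k o := rfl
        rw [h5]
        omega
      · rw [Finset.sum_add_distrib, ← Finset.sum_div]
        gcongr

theorem expect_one_eq (hB : IsSupersolution P R Γ lag B) (hΓ : 1 < Γ) {x : H} {v : ℝ}
    (hx : B ⟨P.start, withAncillas x, 0⟩ 1 v) : P.expect R x (fun _ => 1) = 1 := by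
  have hv : 0 ≤ v := zero_le_one.trans (by simpa using hB.le hx)
  refine le_antisymm ?_ ?_
  · simpa using expect_le_of_truncExpect_le (f := fun _ => 1) (fun _ => zero_le_one)
      fun N => hB.truncExpect_one_le N hx
  · refine ENNReal.le_of_forall_pos_le_add fun ε hε _ => ?_
    obtain ⟨m, hm⟩ := pow_unbounded_of_one_lt (v / ε) hΓ
    have h1 := hB.le_truncExpect_one_add hΓ.le (m := m) (2 * m) hx (by simp)
    have h2 : v / Γ ^ m ≤ ε := by
      rw [div_le_iff₀ (by positivity)]
      rw [div_lt_iff₀ (NNReal.coe_pos.2 hε)] at hm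
      linarith
    have h3 := ofReal_truncExpect_le_expect (P := P) (R := R) (f := fun _ => 1)
      (fun _ => zero_le_one) (2 * m) x
    rw [ENNReal.ofReal_one] at h3
    calc (1 : ℝ≥0∞) = ENNReal.ofReal 1 := by simp
      _ ≤ ENNReal.ofReal (P.truncExpect R (fun _ => 1) (2 * m) ⟨P.start, withAncillas x, 0⟩ + ε) :=
        ENNReal.ofReal_le_ofReal (by linarith)
      _ ≤ _ := ENNReal.ofReal_add_le
      _ ≤ _ := add_le_add h3 (by simp)

theorem expect_pow_le (hB : IsSupersolution P R Γ lag B) (hΓ : 1 ≤ Γ) {x : H} {v : ℝ}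
    (hx : B ⟨P.start, withAncillas x, 0⟩ 1 v) :
    P.expect R x (fun n => ENNReal.ofReal (Γ ^ n)) ≤ ENNReal.ofReal v :=
  expect_le_of_truncExpect_le (fun _ => by positivity) fun N => hB.truncExpect_pow_le hΓ N hx

end IsSupersolution

/-- A property of snapshots that is preserved by rounds holds at the end of every halting run. -/
theorem runFrom_induction {p : Snapshot P.Ctrl H → Prop}
    (hp : ∀ x c k, p x → P.next x.ctrl = some (c, k) → ∀ o, p (x.step R c k o)) (h : List (Fin 2))
    {x y : Snapshot P.Ctrl H} (hx : p x) (hy : P.runFrom R x h = some y) :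
    p y ∧ P.next y.ctrl = none := by
  induction h generalizing x with
  | nil =>
    rcases hn : P.next x.ctrl with _ | ⟨c, k⟩
    · simp only [runFrom, hn, Option.some.injEq] at hy
      exact hy ▸ ⟨hx, hn⟩
    · simp [runFrom, hn] at hy
  | cons o h ih =>
    rcases hn : P.next x.ctrl with _ | ⟨c, k⟩
    · simp [runFrom, hn] at hy
    · simp only [runFrom, hn] at hy
      exact ih (hp x c k hx hn o) hy

/-! ### Consequences of a bound for the generating function -/

/-- Jensen for the logarithm: `n = log_Γ (Γ ^ n)` lies below the tangent line at `Γ ^ b`, whose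
slope is `(log Γ * Γ ^ b)⁻¹`. -/
theorem expect_natCast_le {x : H} (hone : P.expect R x (fun _ => 1) = 1) {Γ b : ℝ} (hΓ : 1 < Γ)
    (hb : 0 ≤ b) (h : P.expect R x (fun n => ENNReal.ofReal (Γ ^ n)) ≤ ENNReal.ofReal (Γ ^ b)) :
    P.expect R x (fun n => (n : ℝ≥0∞)) ≤ ENNReal.ofReal b := by
  have hpos : 0 < Γ ^ b := Real.rpow_pos_of_pos (by linarith) _
  have hlog : 0 < Real.log Γ := Real.log_pos hΓ
  have h1 := expect_le_of_tangent hone (f := fun n => (n : ℝ)) (g := fun n => Γ ^ n) (a := b)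
    (b := (Real.log Γ * Γ ^ b)⁻¹) (fun n => n.cast_nonneg) (fun n => by positivity) hb
    (by positivity) hpos.le (fun n => ?_) h
  · simpa using h1
  · have h2 : (Γ ^ n : ℝ) = Γ ^ b * Real.exp (Real.log Γ * (n - b)) := by
      rw [← Real.rpow_natCast, ← Real.rpow_def_of_pos (by linarith), ← Real.rpow_add (by linarith)]
      ring_nf
    have h3 := Real.add_one_le_exp (Real.log Γ * (n - b))
    rw [h2, mul_inv]
    have h4 : (Real.log Γ)⁻¹ * (Γ ^ b)⁻¹ * Γ ^ b = (Real.log Γ)⁻¹ := by field_simp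
    have h5 : (Real.log Γ)⁻¹ * (Real.log Γ * (n - b) + 1) = n - b + (Real.log Γ)⁻¹ := by
      field_simp
    have h6 := mul_le_mul_of_nonneg_left h3 (inv_nonneg.2 hlog.le)
    rw [← mul_assoc, h4]
    linarith

/-- Jensen for the concave power `X ↦ X ^ t` with `t = log_{Γ₀} Γ ∈ [0, 1]`; the tangent line at `Γ₀
^ b` comes from weighted AM-GM. -/
theorem expect_pow_le_rpow {x : H} (hone : P.expect R x (fun _ => 1) = 1) {Γ₀ Γ b : ℝ}
    (hΓ : 1 ≤ Γ) (hΓ₀ : Γ ≤ Γ₀) (hlt : 1 < Γ₀)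
    (h : P.expect R x (fun n => ENNReal.ofReal (Γ₀ ^ n)) ≤ ENNReal.ofReal (Γ₀ ^ b)) :
    P.expect R x (fun n => ENNReal.ofReal (Γ ^ n)) ≤ ENNReal.ofReal (Γ ^ b) := by
  have hpos₀ : 0 < Γ₀ := by linarith
  set t := Real.logb Γ₀ Γ with ht
  have ht0 : 0 ≤ t := Real.logb_nonneg hlt hΓ
  have ht1 : t ≤ 1 := by
    rw [ht, Real.logb_le_iff_le_rpow hlt (by linarith)]
    simpa
  have hΓt : Γ = Γ₀ ^ t := (Real.rpow_logb hpos₀ hlt.ne' (by linarith)).symm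
  have hm : 0 < Γ₀ ^ b := Real.rpow_pos_of_pos hpos₀ _
  have ha : 0 < Γ ^ b := Real.rpow_pos_of_pos (by linarith) _
  refine expect_le_of_tangent hone (f := fun n => Γ ^ n) (g := fun n => Γ₀ ^ n) (a := Γ ^ b)
    (b := t * Γ ^ b / Γ₀ ^ b) (fun n => by positivity) (fun n => by positivity) ha.le
    (by positivity) hm.le (fun n => ?_) h
  have h1 := Real.geom_mean_le_arith_mean2_weighted (sub_nonneg.2 ht1) ht0 zero_le_one
    (by positivity : 0 ≤ (Γ₀ ^ n : ℝ) / Γ₀ ^ b) (by ring)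
  have h2 : ((Γ₀ ^ n : ℝ) / Γ₀ ^ b) ^ t = Γ ^ n / Γ ^ b := by
    rw [Real.div_rpow (by positivity) hm.le, hΓt, ← Real.rpow_natCast, ← Real.rpow_natCast,
      ← Real.rpow_mul hpos₀.le, ← Real.rpow_mul hpos₀.le, ← Real.rpow_mul hpos₀.le,
      ← Real.rpow_mul hpos₀.le, mul_comm t, mul_comm t]
  rw [h2, Real.one_rpow, one_mul, mul_one, div_le_iff₀ ha] at h1
  have h3 : t * Γ ^ b / Γ₀ ^ b * Γ₀ ^ b = t * Γ ^ b := by field_simp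
  rw [h3]
  calc Γ ^ n + t * Γ ^ b ≤ (1 - t + t * (Γ₀ ^ n / Γ₀ ^ b)) * Γ ^ b + t * Γ ^ b := by gcongr
    _ = Γ ^ b + t * Γ ^ b / Γ₀ ^ b * Γ₀ ^ n := by ring

end Procedure

/-! ### The rounds of `T'_mx` as projections -/

/-- The vector of the joint space with the given components. -/
def joint {E : Type*} (a b c d : E) : Anc → E := fun i => ![![a, b], ![c, d]] i.1 i.2

theorem joint_eta {E : Type*} (v : Anc → E) :
    v = joint (v (0, 0)) (v (0, 1)) (v (1, 0)) (v (1, 1)) := by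
  ext ⟨i, j⟩
  fin_cases i <;> fin_cases j <;> rfl

theorem withAncillas_eq (x : H) : withAncillas x = joint x 0 0 0 := by
  ext ⟨i, j⟩
  fin_cases i <;> fin_cases j <;> simp [withAncillas, joint]

theorem weight_joint (a b c d : H) :
    weight (joint a b c d) = ‖a‖ ^ 2 + ‖b‖ ^ 2 + (‖c‖ ^ 2 + ‖d‖ ^ 2) := by
  simp [weight, joint, Fintype.sum_prod_type, Fin.sum_univ_two]

theorem joint_smul (z : ℂ) (a b c d : H) :
    z • joint a b c d = joint (z • a) (z • b) (z • c) (z • d) := by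
  rw [joint_eta (z • _)]
  rfl

/-- `√(3/4)` as a complex number. -/
def rootThreeFourths : ℂ := ((√(3 / 4) : ℝ) : ℂ)

local notation "ρ" => rootThreeFourths

theorem rootThreeFourths_mul_self : ρ * ρ = 3 / 4 := by
  rw [rootThreeFourths, ← Complex.ofReal_mul, Real.mul_self_sqrt (by norm_num)]
  norm_num

theorem norm_rootThreeFourths_sq : ‖ρ‖ ^ 2 = 3 / 4 := by
  rw [rootThreeFourths, Complex.norm_real, Real.norm_eq_abs, sq_abs, Real.sq_sqrt (by norm_num)]

theorem sqrt_four_eq : √(4 : ℝ) = 2 := by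
  rw [Real.sqrt_eq_iff_mul_self_eq] <;> norm_num

theorem suppressA_apply (R : ℝ → H →ₗᵢ[ℂ] H) (a b c d : H) :
    suppressA.apply R (joint a b c d) =
      joint (ρ • a + (1 / 2 : ℂ) • c) (ρ • b + (1 / 2 : ℂ) • d)
        ((1 / 2 : ℂ) • a - ρ • c) ((1 / 2 : ℂ) • b - ρ • d) := by
  rw [joint_eta (suppressA.apply R _)]
  congr 1 <;>
    simp [suppressA, Gate.apply, joint, suppressMat, Fintype.sum_prod_type, Fin.sum_univ_two,
      Matrix.kroneckerMap_apply, sqrt_four_eq, rootThreeFourths, sub_eq_add_neg]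

theorem hadamardC_apply (R : ℝ → H →ₗᵢ[ℂ] H) (a b c d : H) :
    hadamardC.apply R (joint a b c d) =
      ((1 / √2 : ℝ) : ℂ) • joint (a + b) (a - b) (c + d) (c - d) := by
  rw [joint_eta (hadamardC.apply R _), joint_smul]
  congr 1 <;>
    simp [hadamardC, Gate.apply, joint, hadamardMat, Fintype.sum_prod_type, Fin.sum_univ_two,
      Matrix.kroneckerMap_apply, sub_eq_add_neg]

theorem reflection_source_apply (R : ℝ → H →ₗᵢ[ℂ] H) (s : ℝ) (a b c d : H) :
    (Gate.reflection s {(0, 0), (0, 1)}).apply R (joint a b c d) = joint (R s a) (R s b) c d := by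
  rw [joint_eta ((Gate.reflection _ _).apply R _)]
  congr 1

theorem reflection_control_apply (R : ℝ → H →ₗᵢ[ℂ] H) (s : ℝ) (a b c d : H) :
    (Gate.reflection s {(0, 1)}).apply R (joint a b c d) = joint a (R s b) c d := by
  rw [joint_eta ((Gate.reflection _ _).apply R _)]
  congr 1

theorem collapse_zero_joint (a b c d : H) : collapse 0 (joint a b c d) = joint a 0 c 0 := by
  rw [joint_eta (collapse _ _)]
  congr 1

theorem collapse_one_joint (a b c d : H) : collapse 1 (joint a b c d) = joint b 0 d 0 := by
  rw [joint_eta (collapse _ _)]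
  congr 1

theorem inv_sqrt_two_mul_self : ((1 / √2 : ℝ) : ℂ) * ((1 / √2 : ℝ) : ℂ) = 1 / 2 := by
  rw [← Complex.ofReal_mul, div_mul_div_comm, Real.mul_self_sqrt (by norm_num)]
  norm_num

theorem Circuit.apply_nil (R : ℝ → H →ₗᵢ[ℂ] H) (v : Anc → H) : Circuit.apply R [] v = v := rfl

theorem Circuit.apply_cons (R : ℝ → H →ₗᵢ[ℂ] H) (g : Gate) (c : Circuit) (v : Anc → H) :
    Circuit.apply R (g :: c) v = Circuit.apply R c (g.apply R v) := rfl

theorem Circuit.apply_append (R : ℝ → H →ₗᵢ[ℂ] H) (c c' : Circuit) (v : Anc → H) :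
    Circuit.apply R (c ++ c') v = Circuit.apply R c' (Circuit.apply R c v) :=
  List.foldl_append

section Reflections

variable {R : ℝ → H →ₗᵢ[ℂ] H} {ψ : ℝ → H} {s : ℝ}

/-- Between two Hadamard gates a controlled reflection puts `(1 + R)/2` on `C = 0` and the
projection `(1 - R)/2` on `C = 1`. It is active only for `A = 0`, so the `A = 1` component always
counts as "not found". -/
theorem testTarget_apply (hR : ∀ v, R s v = v - (2 * inner ℂ (ψ s) v) • ψ s) (x y : H) :
    (testTarget s).apply R (joint x 0 y 0) =
      joint (x - inner ℂ (ψ s) x • ψ s) (inner ℂ (ψ s) x • ψ s) y 0 := by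
  simp only [testTarget, Circuit.apply_cons, Circuit.apply_nil, hadamardC_apply, joint_smul,
    reflection_control_apply, hR, inner_smul_right, sub_zero, add_zero]
  have h := inv_sqrt_two_mul_self
  generalize ((1 / √2 : ℝ) : ℂ) = r at h ⊢
  congr 1
  · linear_combination (norm := module) (2 * h) • x - (2 * inner ℂ (ψ s) x * h) • ψ s
  · linear_combination (norm := module) (2 * inner ℂ (ψ s) x * h) • ψ s
  · linear_combination (norm := module) (2 * h) • y
  · module

/-- The component along the source state `ψ s ⊗ (√(3/4) |0⟩ + √(1/4) |1⟩)`. -/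
def sourceCoeff (ψ : ℝ → H) (s : ℝ) (x y : H) : ℂ :=
  ρ * inner ℂ (ψ s) x + (1 / 2 : ℂ) * inner ℂ (ψ s) y

theorem reflectSource_apply (hR : ∀ v, R s v = v - (2 * inner ℂ (ψ s) v) • ψ s) (x y : H) :
    (reflectSource s).apply R (joint x 0 y 0) =
      joint (x - (2 * sourceCoeff ψ s x y * ρ) • ψ s) 0
        (y - (2 * sourceCoeff ψ s x y * (1 / 2)) • ψ s) 0 := by
  simp only [reflectSource, Circuit.apply_cons, Circuit.apply_nil, suppressA_apply,
    reflection_source_apply, hR, smul_zero, add_zero, sub_zero, inner_zero_right, mul_zero,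
    zero_smul, inner_add_right, inner_smul_right, sourceCoeff]
  congr 1
  · linear_combination (norm := module) rootThreeFourths_mul_self • x
  · linear_combination (norm := module) rootThreeFourths_mul_self • y

theorem testSource_apply (hR : ∀ v, R s v = v - (2 * inner ℂ (ψ s) v) • ψ s) (x y : H) :
    (testSource s).apply R (joint x 0 y 0) =
      joint (x - (sourceCoeff ψ s x y * ρ) • ψ s) ((sourceCoeff ψ s x y * ρ) • ψ s)
        (y - (sourceCoeff ψ s x y * (1 / 2)) • ψ s) ((sourceCoeff ψ s x y * (1 / 2)) • ψ s) := by
  -- `suppressA` maps the source to `ψ s ⊗ |0⟩`, so the source test is a conjugated target test.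
  have h : testSource s = [suppressA] ++ (testTarget s ++ [suppressA]) := rfl
  rw [h, Circuit.apply_append, Circuit.apply_append, Circuit.apply_cons, Circuit.apply_nil,
    Circuit.apply_cons, Circuit.apply_nil, suppressA_apply]
  simp only [smul_zero, add_zero, sub_zero]
  rw [testTarget_apply hR, suppressA_apply]
  simp only [inner_add_right, inner_smul_right, sourceCoeff, smul_zero, sub_zero, add_zero]
  congr 1
  · linear_combination (norm := module) rootThreeFourths_mul_self • x
  · module
  · linear_combination (norm := module) rootThreeFourths_mul_self • y
  · module

end Reflections

/-! ### The transitions of `T'_mx` -/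

theorem Gate.apply_smul (R : ℝ → H →ₗᵢ[ℂ] H) (g : Gate) (z : ℂ) (v : Anc → H) :
    g.apply R (z • v) = z • g.apply R v := by
  ext i
  cases g with
  | ancilla M => simp [Gate.apply, Finset.smul_sum, smul_comm z]
  | reflection s ctrl =>
    simp only [Gate.apply, Pi.smul_apply, map_smul]
    split <;> rfl

theorem Circuit.apply_smul (R : ℝ → H →ₗᵢ[ℂ] H) (c : Circuit) (z : ℂ) (v : Anc → H) :
    c.apply R (z • v) = z • c.apply R v := by
  induction c generalizing v with
  | nil => rfl
  | cons g c ih => rw [Circuit.apply_cons, Gate.apply_smul, ih, Circuit.apply_cons]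

theorem collapse_smul (o : Fin 2) (z : ℂ) (v : Anc → H) :
    collapse o (z • v) = z • collapse o v := by
  ext i
  simp only [collapse, Pi.smul_apply]
  split
  · rfl
  · rw [smul_zero]

theorem joint_zero : joint (0 : H) 0 0 0 = 0 := by
  simpa using (joint_smul (0 : ℂ) (0 : H) 0 0 0).symm

/-- The squared overlap of the source and the target of `T'_mx`. -/
def overlap (ψ : ℝ → H) (a b : ℝ) : ℝ := 3 / 4 * ‖inner ℂ (ψ b) (ψ a)‖ ^ 2

/-- The amplitude of the target of `T'_mx` in its source. -/
def amplitude (ψ : ℝ → H) (a b : ℝ) : ℂ := rootThreeFourths * inner ℂ (ψ b) (ψ a)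

theorem norm_amplitude_sq (ψ : ℝ → H) (a b : ℝ) : ‖amplitude ψ a b‖ ^ 2 = overlap ψ a b := by
  rw [amplitude, norm_mul, mul_pow, norm_rootThreeFourths_sq, overlap]

theorem overlap_nonneg (ψ : ℝ → H) (a b : ℝ) : 0 ≤ overlap ψ a b := by
  rw [overlap]; positivity

/-- The reason for the ancilla `A`: even for equal states `p` stays away from `1`, so the
denominator `1 - Γ² p²` of `sourceGen` stays positive at `14/13`. -/
theorem overlap_le {ψ : ℝ → H} {a b : ℝ} (ha : ‖ψ a‖ = 1) (hb : ‖ψ b‖ = 1) :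
    overlap ψ a b ≤ 3 / 4 := by
  have h := norm_inner_le_norm (𝕜 := ℂ) (ψ b) (ψ a)
  rw [ha, hb, mul_one] at h
  have h2 := pow_le_one₀ (n := 2) (norm_nonneg _) h
  rw [overlap]
  linarith

theorem rootThreeFourths_mul_amplitude_mul (ψ : ℝ → H) (a b : ℝ) :
    rootThreeFourths * amplitude ψ a b * inner ℂ (ψ a) (ψ b) = (overlap ψ a b : ℂ) := by
  have h1 : (inner ℂ (ψ b) (ψ a) : ℂ) * inner ℂ (ψ a) (ψ b) =
      ((‖inner ℂ (ψ b) (ψ a)‖ ^ 2 : ℝ) : ℂ) := by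
    rw [← inner_conj_symm (ψ a) (ψ b), Complex.mul_conj, Complex.normSq_eq_norm_sq]
  rw [amplitude, overlap, Complex.ofReal_mul, ← h1]
  push_cast
  linear_combination (inner ℂ (ψ b) (ψ a) * inner ℂ (ψ a) (ψ b)) * rootThreeFourths_mul_self

/-- The unnormalised state at the beginning of each stage of `T'_mx`, up to a scalar. -/
def stageVec (ψ : ℝ → H) (a b : ℝ) : Stage → Anc → H
  | .first => joint (ψ a) 0 0 0
  | .second | .third | .source =>
    joint (rootThreeFourths • ψ a - amplitude ψ a b • ψ b) 0 ((1 / 2 : ℂ) • ψ a) 0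
  | .target =>
    joint ((overlap ψ a b * rootThreeFourths : ℂ) • ψ a - amplitude ψ a b • ψ b) 0
      ((overlap ψ a b * (1 / 2) : ℂ) • ψ a) 0
  | .restore => joint (rootThreeFourths • ψ a) 0 ((1 / 2 : ℂ) • ψ a) 0

/-- The state, up to a scalar, when `T'_mx` continues with a stage or halts with a result. -/
def outcomeVec (ψ : ℝ → H) (a b : ℝ) : Stage ⊕ Bool → Anc → H
  | .inl q => stageVec ψ a b q
  | .inr true => joint (ψ b) 0 0 0
  | .inr false => joint (ψ a) 0 0 0

/-- The scalar acquired in a round of `T'_mx` that starts in the given stage. -/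
def roundScalar (p : ℝ) (c : ℂ) : Stage → Fin 2 → ℂ
  | .first => ![1, c]
  | .second | .third => ![2 * p - 1, -(2 * (1 - p)) * c]
  | .source => ![1, 1 - p]
  | .target => ![p, -(1 - p) * c]
  | .restore => ![1, 0]

section Rounds

variable {R : ℝ → H →ₗᵢ[ℂ] H} {ψ : ℝ → H} {a b : ℝ}

theorem inner_self_eq_one_of_norm {x : H} (h : ‖x‖ = 1) : inner ℂ x x = (1 : ℂ) := by
  rw [inner_self_eq_norm_sq_to_K, h]
  simp

theorem sourceCoeff_stageVec (ha : ‖ψ a‖ = 1) :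
    sourceCoeff ψ a (ρ • ψ a - amplitude ψ a b • ψ b) ((1 / 2 : ℂ) • ψ a) =
      1 - overlap ψ a b := by
  simp only [sourceCoeff, inner_sub_right, inner_smul_right, inner_self_eq_one_of_norm ha]
  linear_combination rootThreeFourths_mul_self - rootThreeFourths_mul_amplitude_mul ψ a b

/-- The quantum part of the argument. With source `σ`, target `τ` and amplitude `c`, a failed target
test leaves a multiple of `σ - c τ`. Reflecting around `σ` and failing again returns the same vector
times `2p - 1`, which is why three stages share one vector. -/
theorem collapse_round (hRa : ∀ v, R a v = v - (2 * inner ℂ (ψ a) v) • ψ a)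
    (hRb : ∀ v, R b v = v - (2 * inner ℂ (ψ b) v) • ψ b) (ha : ‖ψ a‖ = 1) (hb : ‖ψ b‖ = 1)
    (q : Stage) (o : Fin 2) :
    collapse o ((tmxRound a b q).1.apply R (stageVec ψ a b q)) =
      roundScalar (overlap ψ a b) (amplitude ψ a b) q o •
        outcomeVec ψ a b ((tmxRound a b q).2 o) := by
  have hz : ρ * inner ℂ (ψ b) (ψ a) = amplitude ψ a b := rfl
  have hbb := inner_self_eq_one_of_norm hb
  have hsc := sourceCoeff_stageVec (b := b) ha
  have hρ := rootThreeFourths_mul_self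
  have key (q : Stage) (hq : q = .second ∨ q = .third) (o : Fin 2) :
      collapse o ((reflectSource a ++ testTarget b).apply R (stageVec ψ a b q)) =
        roundScalar (overlap ψ a b) (amplitude ψ a b) q o •
          if o = 1 then joint (ψ b) 0 0 0 else
            joint (ρ • ψ a - amplitude ψ a b • ψ b) 0 ((1 / 2 : ℂ) • ψ a) 0 := by
    have h : stageVec ψ a b q =
        joint (ρ • ψ a - amplitude ψ a b • ψ b) 0 ((1 / 2 : ℂ) • ψ a) 0 := by
      rcases hq with rfl | rfl <;> rfl
    have h' : roundScalar (overlap ψ a b) (amplitude ψ a b) q =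
        ![2 * (overlap ψ a b : ℂ) - 1, -(2 * (1 - overlap ψ a b)) * amplitude ψ a b] := by
      rcases hq with rfl | rfl <;> rfl
    rw [h, h', Circuit.apply_append, reflectSource_apply hRa, testTarget_apply hRb, hsc]
    simp only [inner_sub_right, inner_smul_right, hbb]
    fin_cases o
    · simp only [Fin.zero_eta, Matrix.cons_val_zero, collapse_zero_joint, zero_ne_one, if_false,
        joint_smul, smul_zero]
      congr 1
      · linear_combination (norm := module) (-(2 * overlap ψ a b - 1) * hz) • ψ b
      · module
    · simp only [Fin.mk_one, Matrix.cons_val_one, collapse_one_joint, if_true, joint_smul,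
        smul_zero, Matrix.cons_val_fin_one]
      congr 1
      linear_combination (norm := module) ((2 * overlap ψ a b - 1) * hz) • ψ b
  cases q with
  | first =>
    rw [tmxRound, Circuit.apply_cons, stageVec, suppressA_apply]
    simp only [smul_zero, add_zero, sub_zero]
    rw [testTarget_apply hRb, inner_smul_right, hz]
    fin_cases o
    · simp [collapse_zero_joint, outcomeVec, stageVec, roundScalar]
    · simp [collapse_one_joint, outcomeVec, roundScalar, joint_smul]
  | second =>
    rw [tmxRound, key _ (.inl rfl)]
    fin_cases o <;> rfl
  | third =>
    rw [tmxRound, key _ (.inr rfl)]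
    fin_cases o <;> rfl
  | source =>
    rw [tmxRound, stageVec, testSource_apply hRa, hsc]
    fin_cases o
    · simp only [Fin.zero_eta, collapse_zero_joint, outcomeVec, stageVec, roundScalar,
        Matrix.cons_val_zero, one_smul, zero_ne_one, if_false]
      congr 1 <;> module
    · simp only [Fin.mk_one, collapse_one_joint, outcomeVec, stageVec, roundScalar,
        Matrix.cons_val_one, Matrix.cons_val_fin_one, if_true, joint_smul, smul_zero]
      congr 1 <;> module
  | target =>
    rw [tmxRound, stageVec, testTarget_apply hRb]
    simp only [inner_sub_right, inner_smul_right, hbb]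
    fin_cases o
    · simp only [Fin.zero_eta, collapse_zero_joint, outcomeVec, stageVec, roundScalar,
        Matrix.cons_val_zero, zero_ne_one, if_false, joint_smul, smul_zero]
      congr 1
      · linear_combination (norm := module) (-overlap ψ a b * hz) • ψ b
      · module
    · simp only [Fin.mk_one, collapse_one_joint, outcomeVec, roundScalar,
        Matrix.cons_val_one, Matrix.cons_val_fin_one, if_true, joint_smul, smul_zero]
      congr 1
      linear_combination (norm := module) (overlap ψ a b * hz) • ψ b
  | restore =>
    rw [tmxRound, Circuit.apply_cons, Circuit.apply_nil, stageVec, suppressA_apply]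
    fin_cases o
    · simp only [Fin.zero_eta, collapse_zero_joint, outcomeVec, roundScalar,
        Matrix.cons_val_zero, one_smul]
      congr 1
      · linear_combination (norm := module) hρ • ψ a
      · module
    · simp [collapse_one_joint, outcomeVec, roundScalar, joint_zero]

end Rounds

/-! ### The generating function of `T'_mx` -/

/-- The squared norm of `stageVec`, as a function of the squared overlap. -/
def stageWeight (p : ℝ) : Stage → ℝ
  | .first => 1
  | .second | .third | .source => 1 - p
  | .target => p * (1 - p)
  | .restore => 1

/-- The squared norm of `outcomeVec`. -/
def outcomeWeight (p : ℝ) : Stage ⊕ Bool → ℝ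
  | .inl q => stageWeight p q
  | .inr _ => 1

/-- The generating function at `Γ` of the number of reflections used from the stage `source` on,
where a failure is counted with the factor `h`. -/
def sourceGen (Γ p h : ℝ) : ℝ := Γ * (1 - p) ^ 2 * (h + Γ * p) / (1 - Γ ^ 2 * p ^ 2)

/-- The generating function at `Γ` of the number of reflections used from a stage on, where a
failure is counted with the factor `h`. -/
def stageGen (Γ p h : ℝ) : Stage → ℝ
  | .first => Γ * (p + Γ ^ 2 * (4 * (1 - p) ^ 2 * p + (1 - 2 * p) ^ 2 *
      (Γ ^ 2 * (4 * (1 - p) ^ 2 * p + (1 - 2 * p) ^ 2 * sourceGen Γ p h))))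
  | .second => Γ ^ 2 * (4 * (1 - p) ^ 2 * p + (1 - 2 * p) ^ 2 *
      (Γ ^ 2 * (4 * (1 - p) ^ 2 * p + (1 - 2 * p) ^ 2 * sourceGen Γ p h)))
  | .third => Γ ^ 2 * (4 * (1 - p) ^ 2 * p + (1 - 2 * p) ^ 2 * sourceGen Γ p h)
  | .source => sourceGen Γ p h
  | .target => Γ * (p * (1 - p) ^ 2 + p ^ 2 * sourceGen Γ p h)
  | .restore => h

/-- `stageGen` extended to the results of `T'_mx`. -/
def outcomeGen (Γ p h : ℝ) : Stage ⊕ Bool → ℝ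
  | .inl q => stageGen Γ p h q
  | .inr true => 1
  | .inr false => h

/-- These are transition weights between unnormalised vectors; they become probabilities after
multiplication by ratios of `outcomeWeight` to `stageWeight`. -/
theorem norm_roundScalar_sq {p : ℝ} {c : ℂ} (hc : ‖c‖ ^ 2 = p) (q : Stage) :
    (fun o => ‖roundScalar p c q o‖ ^ 2) = match q with
      | .first => ![1, p]
      | .second | .third => ![(1 - 2 * p) ^ 2, 4 * (1 - p) ^ 2 * p]
      | .source => ![1, (1 - p) ^ 2]
      | .target => ![p ^ 2, (1 - p) ^ 2 * p]
      | .restore => ![1, 0] := by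
  have h1 (x : ℝ) : ‖(x : ℂ)‖ ^ 2 = x ^ 2 := by rw [Complex.norm_real, Real.norm_eq_abs, sq_abs]
  have h2 : ‖2 * (p : ℂ) - 1‖ ^ 2 = (1 - 2 * p) ^ 2 := by
    have := h1 (2 * p - 1)
    push_cast at this
    rw [this]; ring
  have h3 : ‖(1 : ℂ) - p‖ ^ 2 = (1 - p) ^ 2 := by
    have := h1 (1 - p)
    push_cast at this
    exact this
  have h4 : ‖-(2 * (1 - (p : ℂ))) * c‖ ^ 2 = 4 * (1 - p) ^ 2 * p := by
    rw [norm_mul, norm_neg, norm_mul, mul_pow, mul_pow, h3, hc]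
    norm_num
  have h5 : ‖-(1 - (p : ℂ)) * c‖ ^ 2 = (1 - p) ^ 2 * p := by
    rw [norm_mul, norm_neg, mul_pow, h3, hc]
  funext o
  cases q <;> fin_cases o <;>
    simp only [roundScalar, Fin.zero_eta, Fin.mk_one, Matrix.cons_val_zero, Matrix.cons_val_one,
      Matrix.cons_val_fin_one, norm_one, one_pow, norm_zero, hc, h1, h2, h3, h4, h5]
  norm_num

theorem sum_outcomeWeight {p : ℝ} {c : ℂ} (hc : ‖c‖ ^ 2 = p) (a b : ℝ) (q : Stage) :
    ∑ o, ‖roundScalar p c q o‖ ^ 2 * outcomeWeight p ((tmxRound a b q).2 o) = stageWeight p q := by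
  simp only [congrFun (norm_roundScalar_sq hc q)]
  cases q <;> simp [tmxRound, outcomeWeight, stageWeight, Fin.sum_univ_two]
  all_goals ring

/-- The alternating measurements form the only loop inside an attempt; `sourceGen` is the sum of its
geometric series of ratio `Γ² p²`. -/
theorem sourceGen_eq {Γ p : ℝ} (h : ℝ) (hp : 1 - Γ ^ 2 * p ^ 2 ≠ 0) :
    sourceGen Γ p h =
      Γ * ((1 - p) ^ 2 * h + Γ * (p * (1 - p) ^ 2 + p ^ 2 * sourceGen Γ p h)) := by
  rw [sourceGen]
  field_simp
  ring

/-- First-step analysis: conditioning on the next outcome, with the reflections of the round charged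
as a power of `Γ`. -/
theorem sum_outcomeGen {Γ p : ℝ} {c : ℂ} (hc : ‖c‖ ^ 2 = p) (hp : 1 - Γ ^ 2 * p ^ 2 ≠ 0)
    (a b h : ℝ) (q : Stage) :
    ∑ o, ‖roundScalar p c q o‖ ^ 2 * (Γ ^ (tmxRound a b q).1.cost *
      outcomeGen Γ p h ((tmxRound a b q).2 o)) = stageGen Γ p h q := by
  simp only [congrFun (norm_roundScalar_sq hc q)]
  cases q
  case source =>
    rw [stageGen, sourceGen_eq h hp]
    simp [tmxRound, outcomeGen, stageGen, Fin.sum_univ_two, Circuit.cost, Gate.cost, testSource,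
      suppressA, hadamardC]
    ring
  all_goals
    simp [tmxRound, outcomeGen, stageGen, Fin.sum_univ_two, Circuit.cost, Gate.cost, testTarget,
      reflectSource, suppressA, hadamardC] <;> ring

/-! ### Numerical estimates at `Γ = 14/13` -/

theorem one_sub_pos {p : ℝ} (h0 : 0 ≤ p) (h1 : p ≤ 3 / 4) : 0 < 1 - (14 / 13 : ℝ) ^ 2 * p ^ 2 := by
  nlinarith

theorem stageWeight_nonneg {p : ℝ} (h0 : 0 ≤ p) (h1 : p ≤ 3 / 4) (q : Stage) :
    0 ≤ stageWeight p q := by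
  cases q <;> simp only [stageWeight] <;> nlinarith

theorem le_sourceGen {p h : ℝ} (h0 : 0 ≤ p) (h1 : p ≤ 3 / 4) (hh : 1 ≤ h) :
    1 - p ≤ sourceGen (14 / 13) p h := by
  rw [sourceGen, le_div_iff₀ (one_sub_pos h0 h1)]
  have h2 : 14 / 13 * (1 - p) ^ 2 * (1 + 14 / 13 * p) ≤
      14 / 13 * (1 - p) ^ 2 * (h + 14 / 13 * p) := by gcongr
  refine le_trans ?_ h2
  have h3 : 0 ≤ (1 - p) * (1 + 14 / 13 * p) := mul_nonneg (by linarith) (by linarith)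
  nlinarith

/-- At `Γ = h = 1` the generating function is the total weight, and raising either parameter can
only increase it. -/
theorem stageWeight_le_stageGen {p h : ℝ} (h0 : 0 ≤ p) (h1 : p ≤ 3 / 4) (hh : 1 ≤ h) (q : Stage) :
    stageWeight p q ≤ stageGen (14 / 13) p h q := by
  have hs := le_sourceGen h0 h1 hh
  have h3 : 1 - p ≤ stageGen (14 / 13) p h .third := by
    have : (1 - 2 * p) ^ 2 * (1 - p) ≤ (1 - 2 * p) ^ 2 * sourceGen (14 / 13) p h := by gcongr
    simp only [stageGen]
    nlinarith
  have h2 : 1 - p ≤ stageGen (14 / 13) p h .second := by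
    have : (1 - 2 * p) ^ 2 * (1 - p) ≤ (1 - 2 * p) ^ 2 * stageGen (14 / 13) p h .third := by gcongr
    simp only [stageGen] at this ⊢
    nlinarith
  cases q with
  | first =>
    simp only [stageGen, stageWeight] at h2 ⊢
    linarith
  | second => exact h2
  | third => exact h3
  | source => exact hs
  | target =>
    have : p ^ 2 * (1 - p) ≤ p ^ 2 * sourceGen (14 / 13) p h := by gcongr
    simp only [stageGen, stageWeight]
    nlinarith
  | restore => exact hh

/-- Whatever the overlap, an attempt costs at most a factor `4`. -/
theorem stageGen_first_le {p h : ℝ} (h0 : 0 ≤ p) (h1 : p ≤ 3 / 4) (hh : 1 ≤ h) :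
    stageGen (14 / 13) p h .first ≤ 4 * h := by
  have hs : sourceGen (14 / 13) p h ≤ 14 / 13 * h := by
    rw [sourceGen, div_le_iff₀ (one_sub_pos h0 h1)]
    have h2 : h + 14 / 13 * p ≤ h * (1 + 14 / 13 * p) := by nlinarith
    calc 14 / 13 * (1 - p) ^ 2 * (h + 14 / 13 * p)
        ≤ 14 / 13 * (1 - p) ^ 2 * (h * (1 + 14 / 13 * p)) := by gcongr
      _ = 14 / 13 * h * (1 + 14 / 13 * p) * (1 - p) ^ 2 := by ring
      -- `(1 - p)² ≤ 1 - (14/13) p` holds for `0 ≤ p ≤ 12/13`; the two linear factors then multiply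
      -- to the denominator.
      _ ≤ 14 / 13 * h * (1 + 14 / 13 * p) * (1 - 14 / 13 * p) := by
        gcongr
        nlinarith
      _ = _ := by ring
  have hA : 4 * (1 - p) ^ 2 * p + (1 - 2 * p) ^ 2 ≤ 1 := by nlinarith [mul_nonneg h0 h0]
  have hA0 : 0 ≤ 4 * (1 - p) ^ 2 * p := by positivity
  have step {y c : ℝ} (hc : 1 ≤ c) (hy : y ≤ c * h) :
      4 * (1 - p) ^ 2 * p + (1 - 2 * p) ^ 2 * y ≤ c * h := by
    have hch : 1 ≤ c * h := one_le_mul_of_one_le_of_one_le hc hh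
    have e1 := le_mul_of_one_le_right hA0 hch
    have e2 := mul_le_mul_of_nonneg_left hy (sq_nonneg (1 - 2 * p))
    have e3 := mul_le_mul_of_nonneg_right hA (zero_le_one.trans hch)
    linarith
  have h3 := step (by norm_num) hs
  have h4 := step (c := (14 / 13) ^ 3) (by norm_num)
    (show (14 / 13) ^ 2 * (4 * (1 - p) ^ 2 * p + (1 - 2 * p) ^ 2 * sourceGen (14 / 13) p h) ≤ _ by
      linarith)
  rw [stageGen]
  linarith

/-- If the overlap is large and the two halves of an interval cost at most a factor `2` each, then
so does the interval. -/
theorem stageGen_first_le_two {p : ℝ} (h0 : 1 / 4 ≤ p) (h1 : p ≤ 3 / 4) :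
    stageGen (14 / 13) p (2 * 2) .first ≤ 2 := by
  have hs : sourceGen (14 / 13) p (2 * 2) ≤ 3 := by
    rw [sourceGen, div_le_iff₀ (one_sub_pos (by linarith) h1)]
    nlinarith [mul_nonneg (sub_nonneg.2 h0) (sub_nonneg.2 h1)]
  -- Each reflection attempt damps the remaining failure branch by at least this factor, which
  -- outweighs the cost `h = 4` of recursing.
  have hB : (1 - 2 * p) ^ 2 ≤ 1 / 4 := by nlinarith
  -- On this range the maximum is `16/27`, attained at `p = 1/3`.
  have hA : 4 * (1 - p) ^ 2 * p ≤ 3 / 5 := by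
    nlinarith [mul_nonneg (sub_nonneg.2 h0) (sq_nonneg (p - 1 / 3)), sq_nonneg (p - 1 / 3)]
  have hC : p + (14 / 13) ^ 2 * (4 * (1 - p) ^ 2 * p) ≤ 11 / 10 := by
    nlinarith [mul_nonneg (sub_nonneg.2 h0) (sq_nonneg (p - 1 / 2)), sq_nonneg (p - 1 / 2)]
  have h3 : (1 - 2 * p) ^ 2 * sourceGen (14 / 13) p (2 * 2) ≤ 1 / 4 * 3 :=
    (mul_le_mul_of_nonneg_left hs (sq_nonneg _)).trans (by linarith)
  have h4 : (14 / 13) ^ 2 * (4 * (1 - p) ^ 2 * p +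
      (1 - 2 * p) ^ 2 * sourceGen (14 / 13) p (2 * 2)) ≤ 8 / 5 := by linarith
  have h5 := (mul_le_mul_of_nonneg_left h4 (sq_nonneg (1 - 2 * p))).trans
    (mul_le_mul_of_nonneg_right hB (by norm_num))
  rw [stageGen]
  linarith

/-! ### The generating function of the recursion -/

/-- `IntervalBound L θ a b g`: the interval `[a, b]` can be bisected repeatedly until all parts have
length at most `θ`, and this yields the bound `g` for the generating function of the traversal. -/
inductive IntervalBound (L : ℝ → ℝ) (θ : ℝ) : ℝ → ℝ → ℝ → Prop
  | leaf (a b : ℝ) : 0 ≤ a → a < b → b ≤ 1 → L b - L a ≤ θ → IntervalBound L θ a b 2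
  | node (a b g₁ g₂ : ℝ) : IntervalBound L θ a ((a + b) / 2) g₁ →
      IntervalBound L θ ((a + b) / 2) b g₂ → IntervalBound L θ a b (4 * (g₁ * g₂))

/-- The product of the bounds for consecutive intervals that lead from a point to `1`. -/
inductive PathBound (L : ℝ → ℝ) (θ : ℝ) : ℝ → List (ℝ × ℝ) → ℝ → Prop
  | nil : PathBound L θ 1 [] 1
  | cons (a b : ℝ) (rest : List (ℝ × ℝ)) (g G : ℝ) : IntervalBound L θ a b g →
      PathBound L θ b rest G → PathBound L θ a ((a, b) :: rest) (g * G)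

variable {L : ℝ → ℝ} {θ : ℝ}

theorem IntervalBound.bounds {a b g : ℝ} (h : IntervalBound L θ a b g) :
    0 ≤ a ∧ a < b ∧ b ≤ 1 := by
  induction h with
  | leaf a b h0 h1 h2 h3 => exact ⟨h0, h1, h2⟩
  | node a b g₁ g₂ _ _ ih₁ ih₂ => exact ⟨ih₁.1, by linarith [ih₁.2.1, ih₂.2.1], ih₂.2.2⟩

theorem IntervalBound.one_le {a b g : ℝ} (h : IntervalBound L θ a b g) : 1 ≤ g := by
  induction h with
  | leaf a b h0 h1 h2 h3 => norm_num
  | node a b g₁ g₂ _ _ ih₁ ih₂ =>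
    have := one_le_mul_of_one_le_of_one_le ih₁ ih₂
    linarith

theorem PathBound.one_le {a G : ℝ} {l : List (ℝ × ℝ)} (h : PathBound L θ a l G) : 1 ≤ G := by
  induction h with
  | nil => exact le_rfl
  | cons a b rest g G hg _ ih => exact one_le_mul_of_one_le_of_one_le hg.one_le ih

/-- A path of unit vectors with the reflections around them, and a monotone function `L` such that
an increment of `L` of at most `θ` enforces a large overlap. -/
structure IsReflectionPath (R : ℝ → H →ₗᵢ[ℂ] H) (ψ : ℝ → H) (L : ℝ → ℝ) (θ : ℝ) : Prop where
  reflect : ∀ s ∈ Set.Icc (0 : ℝ) 1, ∀ v, R s v = v - (2 * inner ℂ (ψ s) v) • ψ s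
  norm_eq : ∀ s ∈ Set.Icc (0 : ℝ) 1, ‖ψ s‖ = 1
  mono : MonotoneOn L (Set.Icc 0 1)
  overlap_ge : ∀ a b, 0 ≤ a → a < b → b ≤ 1 → L b - L a ≤ θ → 1 / 4 ≤ overlap ψ a b

variable {R : ℝ → H →ₗᵢ[ℂ] H} {ψ : ℝ → H}

theorem IsReflectionPath.overlap_le (hψ : IsReflectionPath R ψ L θ) {a b : ℝ} (ha : 0 ≤ a)
    (hab : a < b) (hb : b ≤ 1) : overlap ψ a b ≤ 3 / 4 :=
  Eigenpath.overlap_le (hψ.norm_eq a ⟨ha, by linarith⟩) (hψ.norm_eq b ⟨by linarith, hb⟩)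

/-- A bound survives the next bisection whether or not it was planned for: by monotonicity of `L`,
halves of a leaf are again leaves with bound `2`, so leaves may be split forever. -/
theorem IntervalBound.exists_split (hψ : IsReflectionPath R ψ L θ) {a b g : ℝ}
    (h : IntervalBound L θ a b g) : ∃ g₁ g₂, IntervalBound L θ a ((a + b) / 2) g₁ ∧
      IntervalBound L θ ((a + b) / 2) b g₂ ∧
      stageGen (14 / 13) (overlap ψ a b) (g₁ * g₂) .first ≤ g := by
  obtain ⟨ha, hab, hb⟩ := h.bounds
  have hp := hψ.overlap_le ha hab hb
  cases h with
  | leaf _ _ _ _ _ hL =>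
    have hm₁ : a < (a + b) / 2 := by linarith
    have hm₂ : (a + b) / 2 < b := by linarith
    have hM₁ := hψ.mono (a := a) (b := (a + b) / 2) ⟨ha, by linarith⟩
      ⟨by linarith, by linarith⟩ hm₁.le
    have hM₂ := hψ.mono (a := (a + b) / 2) (b := b) ⟨by linarith, by linarith⟩
      ⟨by linarith, hb⟩ hm₂.le
    exact ⟨2, 2, .leaf _ _ ha hm₁ (by linarith) (by linarith),
      .leaf _ _ (by linarith) hm₂ hb (by linarith),
      stageGen_first_le_two (hψ.overlap_ge a b ha hab hb hL) hp⟩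
  | node _ _ g₁ g₂ h₁ h₂ =>
    exact ⟨g₁, g₂, h₁, h₂, stageGen_first_le (overlap_nonneg _ _ _) hp
      (one_le_mul_of_one_le_of_one_le h₁.one_le h₂.one_le)⟩

/-- The snapshots that occur in the recursion, with their weights and bounds for the
generating function of the number of reflections. -/
inductive Reach (ψ : ℝ → H) (L : ℝ → ℝ) (θ : ℝ) : Snapshot treeTraversal.Ctrl H → ℝ → ℝ → Prop
  | halted (z : ℂ) (n : ℕ) (v : ℝ) : ‖z‖ ^ 2 * (14 / 13) ^ n ≤ v →
      Reach ψ L θ ⟨(.first, []), z • joint (ψ 1) 0 0 0, n⟩ (‖z‖ ^ 2) v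
  | running (q : Stage) (a b : ℝ) (rest : List (ℝ × ℝ)) (z : ℂ) (n : ℕ) (g₁ g₂ G v : ℝ) :
      IntervalBound L θ a ((a + b) / 2) g₁ → IntervalBound L θ ((a + b) / 2) b g₂ →
      PathBound L θ b rest G →
      ‖z‖ ^ 2 * (14 / 13) ^ n * (stageGen (14 / 13) (overlap ψ a b) (g₁ * g₂) q * G) ≤ v →
      Reach ψ L θ ⟨(q, (a, b) :: rest), z • stageVec ψ a b q, n⟩
        (‖z‖ ^ 2 * stageWeight (overlap ψ a b) q) v

theorem PathBound.reach (hψ : IsReflectionPath R ψ L θ) {a G : ℝ} {l : List (ℝ × ℝ)}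
    (h : PathBound L θ a l G) (z : ℂ) (n : ℕ) :
    Reach ψ L θ ⟨(.first, l), z • joint (ψ a) 0 0 0, n⟩ (‖z‖ ^ 2)
      (‖z‖ ^ 2 * (14 / 13) ^ n * G) := by
  cases h with
  | nil => exact .halted z n _ (by rw [mul_one])
  | cons _ b rest g G hg hG =>
    obtain ⟨g₁, g₂, h₁, h₂, h₃⟩ := hg.exists_split hψ
    have hG0 : 0 ≤ G := zero_le_one.trans hG.one_le
    have := Reach.running (ψ := ψ) .first a b rest z n g₁ g₂ G
      (‖z‖ ^ 2 * (14 / 13) ^ n * (g * G)) h₁ h₂ hG (by gcongr)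
    rwa [stageWeight, mul_one] at this

/-- The factor `g₁ * g₂` charged for a failure inside `stageGen` is exactly what the two halves
contribute once they head the list of pending intervals. -/
theorem Reach.outcome (hψ : IsReflectionPath R ψ L θ) {a b g₁ g₂ G : ℝ} {rest : List (ℝ × ℝ)}
    (h₁ : IntervalBound L θ a ((a + b) / 2) g₁) (h₂ : IntervalBound L θ ((a + b) / 2) b g₂)
    (hG : PathBound L θ b rest G) (z : ℂ) (n : ℕ) (r : Stage ⊕ Bool) :
    Reach ψ L θ ⟨match r with
        | .inl q' => (q', (a, b) :: rest)
        | .inr true => (.first, rest)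
        | .inr false => (.first, (a, (a + b) / 2) :: ((a + b) / 2, b) :: rest),
      z • outcomeVec ψ a b r, n⟩ (‖z‖ ^ 2 * outcomeWeight (overlap ψ a b) r)
      (‖z‖ ^ 2 * (14 / 13) ^ n * (outcomeGen (14 / 13) (overlap ψ a b) (g₁ * g₂) r * G)) := by
  rcases r with q' | _ | _
  · exact .running q' a b rest z n g₁ g₂ G _ h₁ h₂ hG le_rfl
  · simp only [outcomeWeight, outcomeGen, outcomeVec, mul_one]
    rw [mul_assoc g₁]
    exact (PathBound.cons _ _ _ _ _ h₁ (.cons _ _ _ _ _ h₂ hG)).reach hψ z n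
  · simp only [outcomeWeight, outcomeGen, outcomeVec, mul_one, one_mul]
    exact hG.reach hψ z n

/-- The stage `restore` uses no reflection, but it is reached only after one. -/
def restoreLag (q : treeTraversal.Ctrl) : ℕ :=
  match q.1 with
  | .restore => 0
  | _ => 1

theorem restoreLag_add_one_le (a b : ℝ) (q : Stage) (l rest : List (ℝ × ℝ)) (o : Fin 2) :
    restoreLag (q, l) + 1 ≤ 2 * (tmxRound a b q).1.cost +
      restoreLag (match (tmxRound a b q).2 o with
        | .inl q' => (q', (a, b) :: rest)
        | .inr true => (.first, rest)
        | .inr false => (.first, (a, (a + b) / 2) :: ((a + b) / 2, b) :: rest)) := by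
  cases q <;> fin_cases o <;> simp [restoreLag, tmxRound, Circuit.cost, Gate.cost, testTarget,
    testSource, reflectSource, suppressA, hadamardC]

theorem isSupersolution_reach (hψ : IsReflectionPath R ψ L θ) :
    treeTraversal.IsSupersolution R (14 / 13) restoreLag (Reach ψ L θ) where
  nonneg := by
    intro x w v h
    cases h with
    | halted => positivity
    | running q a b rest z n g₁ g₂ G v h₁ h₂ =>
      have hab : a < b := by linarith [h₁.bounds.2.1, h₂.bounds.2.1]
      exact mul_nonneg (by positivity) (stageWeight_nonneg (overlap_nonneg _ _ _)
        (hψ.overlap_le h₁.bounds.1 hab h₂.bounds.2.2) q)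
  le := by
    intro x w v h
    cases h with
    | halted z n v h => exact h
    | running q a b rest z n g₁ g₂ G v h₁ h₂ hG h =>
      have hab : a < b := by linarith [h₁.bounds.2.1, h₂.bounds.2.1]
      have hp := hψ.overlap_le h₁.bounds.1 hab h₂.bounds.2.2
      have hp0 := overlap_nonneg ψ a b
      have hw := stageWeight_le_stageGen hp0 hp
        (one_le_mul_of_one_le_of_one_le h₁.one_le h₂.one_le) q
      have hs := (stageWeight_nonneg hp0 hp q).trans hw
      refine le_trans ?_ h
      rw [mul_right_comm]
      exact mul_le_mul_of_nonneg_left (hw.trans (le_mul_of_one_le_right hs hG.one_le))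
        (by positivity)
  halt := by
    intro x w v h hn
    cases h with
    | halted z n v h =>
      rw [joint_smul, weight_joint, norm_smul, hψ.norm_eq 1 (by simp)]
      simp
    | running => simp [treeTraversal] at hn
  lag_le := by
    rintro ⟨q, l⟩
    cases q <;> simp [restoreLag]
  step := by
    intro x w v c k h hn
    cases h with
    | halted => simp [treeTraversal] at hn
    | running q a b rest z n g₁ g₂ G v h₁ h₂ hG h =>
      simp only [treeTraversal, Option.some.injEq] at hn
      obtain ⟨rfl, rfl⟩ := hn
      have hab : a < b := by linarith [h₁.bounds.2.1, h₂.bounds.2.1]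
      have ha : a ∈ Set.Icc (0 : ℝ) 1 := ⟨h₁.bounds.1, by linarith [h₂.bounds.2.2]⟩
      have hb : b ∈ Set.Icc (0 : ℝ) 1 := ⟨by linarith [h₁.bounds.1], h₂.bounds.2.2⟩
      set p := overlap ψ a b with hp
      set σ := roundScalar p (amplitude ψ a b) q with hσ
      set r := (tmxRound a b q).2 with hr
      set m := (tmxRound a b q).1.cost with hm
      have hpos := (one_sub_pos (overlap_nonneg ψ a b) (hψ.overlap_le ha.1 hab hb.2)).ne'
      refine ⟨fun o => ‖z * σ o‖ ^ 2 * outcomeWeight p (r o),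
        fun o => ‖z * σ o‖ ^ 2 * (14 / 13) ^ (n + m) *
          (outcomeGen (14 / 13) p (g₁ * g₂) (r o) * G), ?_, ?_, fun o => ⟨?_, ?_⟩⟩
      · rw [← sum_outcomeWeight (norm_amplitude_sq ψ a b) a b q, Finset.mul_sum]
        exact Finset.sum_congr rfl fun o _ => by simp only [norm_mul, mul_pow, mul_assoc]; rfl
      · refine le_trans (le_of_eq ?_) h
        rw [← sum_outcomeGen (norm_amplitude_sq ψ a b) hpos a b (g₁ * g₂) q, Finset.sum_mul,
          Finset.mul_sum]
        refine Finset.sum_congr rfl fun o _ => ?_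
        simp only [norm_mul, mul_pow, pow_add]
        ring
      -- The scalar `z` collects the whole measurement history; gates and measurements are linear,
      -- so it passes through the round.
      · have hv := Reach.outcome hψ h₁ h₂ hG (z * σ o) (n + m) (r o)
        rw [mul_smul, ← collapse_round (hψ.reflect a ha) (hψ.reflect b hb) (hψ.norm_eq a ha)
          (hψ.norm_eq b hb), ← collapse_smul, ← Circuit.apply_smul] at hv
        exact hv
      · have hc := restoreLag_add_one_le a b q ((a, b) :: rest) rest o
        simp only [Snapshot.step]
        refine le_trans ?_ (Nat.add_le_add_left hc (2 * n)) |>.trans ?_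
        · rw [add_assoc]
        · rw [mul_add, add_assoc]
          exact le_rfl

/-! ### The number of bisections -/

section Bisection

/-- The tangent line at `s` of the concave function `c ↦ c log₂(t/c)`, obtained from `log u ≤ u - 1`
at `u = s/c`. -/
theorem mul_logb_two_div_le {c s t : ℝ} (hc : 0 < c) (hs : 0 < s) (ht : 0 < t) :
    c * Real.logb 2 (t / c) ≤ c * Real.logb 2 (t / s) + (s - c) / Real.log 2 := by
  have h2 : 0 < Real.log 2 := Real.log_pos (by norm_num)
  have h : t / c = t / s * (s / c) := by field_simp
  have hts : 0 < t / s := div_pos ht hs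
  have hsc : 0 < s / c := div_pos hs hc
  rw [h, Real.logb, Real.logb, Real.log_mul hts.ne' hsc.ne', add_div, mul_add]
  have h3 := mul_le_mul_of_nonneg_left (Real.log_le_sub_one_of_pos hsc) hc.le
  rw [mul_sub, mul_div_cancel₀ _ hc.ne', mul_one] at h3
  rw [← mul_div_assoc c (Real.log (s / c))]
  gcongr

theorem two_le_bisection {x y : ℝ} (hx : 1 < x) (hxy : x ≤ y) :
    2 ≤ x * (Real.logb 2 (y / x) + 3) := by
  have h : 0 ≤ Real.logb 2 (y / x) :=
    Real.logb_nonneg (by norm_num) ((one_le_div (by linarith)).2 hxy)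
  nlinarith

/-- For one long half: halving `y` lowers the logarithm by `1`, which gains `x₁ > 1` and pays for
the extra bisection. The tangent correction is absorbed by `3 (x - x₁)` because `1 / log 2 ≤ 3`. -/
theorem bisection_add_one_le {x₁ x y : ℝ} (h₁ : 1 < x₁) (hx : x₁ ≤ x) (hxy : x ≤ y) :
    x₁ * (Real.logb 2 (y / 2 / x₁) + 3) + 1 ≤ x * (Real.logb 2 (y / x) + 3) := by
  have hx0 : 0 < x := by linarith
  have hy0 : 0 < y := by linarith
  have h := mul_logb_two_div_le (c := x₁) (s := x) (t := y / 2) (by linarith) hx0 (by linarith)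
  have hl : 0 ≤ Real.logb 2 (y / x) := Real.logb_nonneg (by norm_num) ((one_le_div hx0).2 hxy)
  have h1 : Real.logb 2 (y / 2 / x) = Real.logb 2 (y / x) - 1 := by
    rw [div_right_comm, Real.logb_div (by positivity) (by norm_num),
      Real.logb_self_eq_one (by norm_num)]
  have h2 := Real.log_two_gt_d9
  have h3 : (x - x₁) / Real.log 2 ≤ 3 * (x - x₁) := by
    rw [div_le_iff₀ (by linarith)]
    nlinarith
  rw [h1] at h
  nlinarith [mul_nonneg (sub_nonneg.2 hx) hl]

/-- For two long halves: with both tangents taken at the mean, the linear corrections cancel. -/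
theorem bisection_add_le {x₁ x₂ y : ℝ} (h₁ : 1 < x₁) (h₂ : 1 < x₂) (hxy : x₁ + x₂ ≤ y) :
    x₁ * (Real.logb 2 (y / 2 / x₁) + 3) + x₂ * (Real.logb 2 (y / 2 / x₂) + 3) ≤
      (x₁ + x₂) * (Real.logb 2 (y / (x₁ + x₂)) + 3) := by
  have hx : 0 < (x₁ + x₂) / 2 := by linarith
  have h : y / 2 / ((x₁ + x₂) / 2) = y / (x₁ + x₂) := by field_simp
  have e₁ := mul_logb_two_div_le (c := x₁) (t := y / 2) (by linarith) hx (by linarith)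
  have e₂ := mul_logb_two_div_le (c := x₂) (t := y / 2) (by linarith) hx (by linarith)
  have e₃ : ((x₁ + x₂) / 2 - x₁) / Real.log 2 + ((x₁ + x₂) / 2 - x₂) / Real.log 2 = 0 := by ring
  rw [h] at e₁ e₂
  linarith

/-- The number of bisections needed to reach lengths of at most `θ`, when lengths greater than `θ`
are bounded by `V` times the size of the interval. -/
theorem exists_intervalBound {L : ℝ → ℝ} {θ V : ℝ} (hθ : 0 < θ)
    (hL : MonotoneOn L (Set.Icc 0 1))
    (hV : ∀ a b, 0 ≤ a → a < b → b ≤ 1 → θ < L b - L a → L b - L a ≤ V * (b - a)) (k : ℕ)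
    {a b : ℝ} (ha : 0 ≤ a) (hab : a < b) (hb : b ≤ 1) (hk : V * (b - a) / θ ≤ 2 ^ k) :
    ∃ N : ℕ, IntervalBound L θ a b (2 * 8 ^ N) ∧ (L b - L a ≤ θ → N = 0) ∧
      (θ < L b - L a → (N : ℝ) + 1 ≤
        (L b - L a) / θ * (Real.logb 2 (V * (b - a) / θ / ((L b - L a) / θ)) + 3)) := by
  -- `k` bounds the remaining depth: once `V (b - a) ≤ θ`, the velocity bound rules out a length
  -- above `θ`. The quantity estimated is `N + 1`, the number of final parts, which is additive
  -- under bisection.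
  induction k generalizing a b with
  | zero =>
    rcases le_or_gt (L b - L a) θ with h | h
    · exact ⟨0, by simpa using .leaf a b ha hab hb h, fun _ => rfl, fun h' => absurd h h'.not_ge⟩
    · have h1 := hV a b ha hab hb h
      rw [pow_zero, div_le_one hθ] at hk
      linarith
  | succ k ih =>
    rcases le_or_gt (L b - L a) θ with h | h
    · exact ⟨0, by simpa using .leaf a b ha hab hb h, fun _ => rfl, fun h' => absurd h h'.not_ge⟩
    set m := (a + b) / 2 with hm
    have ham : a < m := by rw [hm]; linarith
    have hmb : m < b := by rw [hm]; linarith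
    set y := V * (b - a) / θ with hy
    have hy₁ : V * (m - a) / θ = y / 2 := by rw [hy, hm]; ring
    have hy₂ : V * (b - m) / θ = y / 2 := by rw [hy, hm]; ring
    have hy2 : y / 2 ≤ 2 ^ k := by rw [pow_succ] at hk; linarith
    obtain ⟨N₁, hI₁, hz₁, hN₁⟩ := ih ha ham (hmb.le.trans hb) (hy₁.le.trans hy2)
    obtain ⟨N₂, hI₂, hz₂, hN₂⟩ := ih (ha.trans ham.le) hmb hb (hy₂.le.trans hy2)
    rw [hy₁] at hN₁
    rw [hy₂] at hN₂
    have hm1 : m ∈ Set.Icc (0 : ℝ) 1 := ⟨ha.trans ham.le, hmb.le.trans hb⟩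
    have hL₁ := hL ⟨ha, hab.le.trans hb⟩ hm1 ham.le
    have hL₂ := hL hm1 ⟨ha.trans hab.le, hb⟩ hmb.le
    have hx : (L b - L a) / θ = (L m - L a) / θ + (L b - L m) / θ := by ring
    have hxy : (L m - L a) / θ + (L b - L m) / θ ≤ y := by
      rw [← hx, hy]
      exact div_le_div_of_nonneg_right (hV a b ha hab hb h) hθ.le
    have hx0 : 1 < (L m - L a) / θ + (L b - L m) / θ := by rw [← hx, lt_div_iff₀ hθ]; linarith
    have hx₁ : 0 ≤ (L m - L a) / θ := div_nonneg (by linarith) hθ.le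
    have hx₂ : 0 ≤ (L b - L m) / θ := div_nonneg (by linarith) hθ.le
    refine ⟨N₁ + N₂ + 1, ?_, fun h' => absurd h h'.not_gt, fun _ => ?_⟩
    · have := IntervalBound.node a b _ _ hI₁ hI₂
      -- `4 * 2 * 2 = 2 * 8`: each bisection costs a factor `8`.
      convert this using 1
      ring
    rw [hx]
    push_cast
    -- A short half needs no bisection, but the logarithmic estimate is unavailable for it; hence
    -- the case distinction.
    rcases le_or_gt (L m - L a) θ with g₁ | g₁ <;> rcases le_or_gt (L b - L m) θ with g₂ | g₂
    · rw [hz₁ g₁, hz₂ g₂]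
      have := two_le_bisection hx0 hxy
      push_cast
      linarith
    · rw [hz₁ g₁]
      have := bisection_add_one_le ((one_lt_div hθ).2 g₂) (le_add_of_nonneg_left hx₁) hxy
      have := hN₂ g₂
      push_cast
      linarith
    · rw [hz₂ g₂]
      have := bisection_add_one_le ((one_lt_div hθ).2 g₁) (le_add_of_nonneg_right hx₂) hxy
      have := hN₁ g₁
      push_cast
      linarith
    · have := bisection_add_le ((one_lt_div hθ).2 g₁) ((one_lt_div hθ).2 g₂) hxy
      have := hN₁ g₁
      have := hN₂ g₂
      linarith

end Bisection

/-! ### Angular length -/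

section ArcLength

variable {ψ : ℝ → H}

theorem arcLength_zero (ψ : ℝ → H) : arcLength ψ 0 = 0 := by
  refine le_antisymm (sSup_le ?_) zero_le
  rintro l ⟨n, t, ht, h0, h1, rfl⟩
  have hn : n = 0 := by
    by_contra hn
    have : t 0 < t (Fin.last n) := ht (Fin.pos_iff_ne_zero.2 fun h => hn (by simpa using h))
    linarith
  subst hn
  simp

/-- Appending `b` to a partition of `[0, a]` gives a partition of `[0, b]`. This inequality
suffices; additivity of the arc length over intervals is never used. -/
theorem arcLength_add_angDist_le {a b : ℝ} (ha : 0 ≤ a) (hab : a < b) :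
    arcLength ψ a + ENNReal.ofReal (angDist (ψ b) (ψ a)) ≤ arcLength ψ b := by
  rw [arcLength, ENNReal.sSup_add]
  · refine iSup₂_le ?_
    rintro l ⟨n, t, ht, h0, h1, rfl⟩
    refine le_sSup ⟨n + 1, Fin.snoc (α := fun _ => ℝ) t b, ?_, ?_, ?_, ?_⟩
    · rw [Fin.strictMono_iff_lt_succ]
      intro i
      rw [Fin.snoc_castSucc]
      induction i using Fin.lastCases with
      | last => rwa [Fin.succ_last, Fin.snoc_last, h1]
      | cast j =>
        rw [Fin.succ_castSucc, Fin.snoc_castSucc]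
        exact ht j.castSucc_lt_succ
    · rw [← Fin.castSucc_zero, Fin.snoc_castSucc, h0]
    · rw [Fin.snoc_last]
    · rw [Fin.sum_univ_castSucc]
      simp only [Fin.snoc_castSucc, Fin.succ_castSucc, Fin.succ_last, Fin.snoc_last, h1]
  -- Adding a constant to a supremum requires some partition of `[0, a]` to exist; for `a = 0` it is
  -- the one-point partition.
  · rcases ha.eq_or_lt with rfl | ha
    · exact ⟨_, 0, fun _ => 0, fun i j h => by omega, rfl, rfl, rfl⟩
    · refine ⟨_, 1, ![0, a], ?_, rfl, rfl, rfl⟩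
      rw [Fin.strictMono_iff_lt_succ]
      intro i
      fin_cases i
      simpa using ha

theorem arcLength_mono {a b : ℝ} (ha : 0 ≤ a) (hab : a ≤ b) : arcLength ψ a ≤ arcLength ψ b := by
  rcases hab.eq_or_lt with rfl | hab
  · exact le_rfl
  · exact le_self_add.trans (arcLength_add_angDist_le ha hab)

theorem arcLength_ne_top (hfin : arcLength ψ 1 ≠ ⊤) {s : ℝ} (hs : s ∈ Set.Icc (0 : ℝ) 1) :
    arcLength ψ s ≠ ⊤ :=
  ne_top_of_le_ne_top hfin (arcLength_mono hs.1 hs.2)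

theorem monotoneOn_toReal_arcLength (hfin : arcLength ψ 1 ≠ ⊤) :
    MonotoneOn (fun s => (arcLength ψ s).toReal) (Set.Icc 0 1) := fun _ ha _ hb hab =>
  ENNReal.toReal_mono (arcLength_ne_top hfin hb) (arcLength_mono ha.1 hab)

theorem angDist_le_sub (hfin : arcLength ψ 1 ≠ ⊤) {a b : ℝ} (ha : 0 ≤ a) (hab : a < b)
    (hb : b ≤ 1) : angDist (ψ b) (ψ a) ≤ (arcLength ψ b).toReal - (arcLength ψ a).toReal := by
  have hbt := arcLength_ne_top hfin ⟨ha.trans hab.le, hb⟩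
  have hat := arcLength_ne_top hfin ⟨ha, hab.le.trans hb⟩
  have h := ENNReal.toReal_mono hbt (arcLength_add_angDist_le (ψ := ψ) ha hab)
  have h0 : 0 ≤ angDist (ψ b) (ψ a) := Real.arccos_nonneg _
  rw [ENNReal.toReal_add hat ENNReal.ofReal_ne_top, ENNReal.toReal_ofReal h0] at h
  linarith

/-- This fixes `θ`: the cosine turns the bound on the angle into `|⟨ψ b, ψ a⟩|² ≥ 1/3`, and overlap
suppression multiplies it by `3/4`. -/
theorem overlap_ge_of_sub_le (hfin : arcLength ψ 1 ≠ ⊤)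
    (hψ : ∀ s ∈ Set.Icc (0 : ℝ) 1, ‖ψ s‖ = 1) {a b : ℝ} (ha : 0 ≤ a) (hab : a < b) (hb : b ≤ 1)
    (h : (arcLength ψ b).toReal - (arcLength ψ a).toReal ≤ Real.arccos √(1 / 3)) :
    1 / 4 ≤ overlap ψ a b := by
  have h1 := (angDist_le_sub hfin ha hab hb).trans h
  rw [angDist] at h1
  have h2 : ‖inner ℂ (ψ b) (ψ a)‖ ≤ 1 := by
    have := norm_inner_le_norm (𝕜 := ℂ) (ψ b) (ψ a)
    rwa [hψ a ⟨ha, by linarith⟩, hψ b ⟨by linarith, hb⟩, mul_one] at this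
  have h3 := norm_nonneg (inner ℂ (ψ b) (ψ a))
  have h4 : √(1 / 3) ≤ ‖inner ℂ (ψ b) (ψ a)‖ := by
    have h5 := Real.cos_le_cos_of_nonneg_of_le_pi (Real.arccos_nonneg _) (Real.arccos_le_pi _) h1
    rwa [Real.cos_arccos (by linarith [Real.sqrt_nonneg (1 / 3)])
      (Real.sqrt_le_one.2 (by norm_num)), Real.cos_arccos (by linarith) h2] at h5
  have h6 := (Real.sqrt_le_left h3).1 h4
  rw [overlap]
  linarith

theorem sub_le_vMax_mul (hfin : arcLength ψ 1 ≠ ⊤) {θ : ℝ}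
    (hv : BddAbove (speeds ψ θ)) {a b : ℝ} (ha : 0 ≤ a) (hab : a < b) (hb : b ≤ 1)
    (h : θ < (arcLength ψ b).toReal - (arcLength ψ a).toReal) :
    (arcLength ψ b).toReal - (arcLength ψ a).toReal ≤ vMax ψ θ * (b - a) := by
  have h1 := monotoneOn_toReal_arcLength hfin ⟨ha.trans hab.le, hb⟩ ⟨zero_le_one, le_rfl⟩ hb
  -- A subinterval longer than `θ` makes the whole path longer than `θ`, so `vMax` is the supremum
  -- and not its fallback value.
  have h2 : ¬ (arcLength ψ 1).toReal ≤ θ := by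
    have := ENNReal.toReal_nonneg (a := arcLength ψ a)
    simp only at h1
    linarith
  rw [vMax, if_neg h2, ← div_le_iff₀ (by linarith)]
  exact le_csSup hv ⟨a, b, ha, hab, hb, h, rfl⟩

end ArcLength

/-! ### The main theorem -/

/-- The origin of the constants `40` and `10` in the bound on the mean. -/
theorem two_mul_eight_pow_le (N : ℕ) : (2 * 8 ^ N : ℝ) ≤ (14 / 13) ^ (40 * N + 10) := by
  have h1 : (2 : ℝ) ≤ (14 / 13) ^ 10 := by norm_num
  have h2 : (8 : ℝ) ≤ (14 / 13) ^ 40 := by norm_num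
  rw [pow_add, pow_mul, mul_comm]
  gcongr

theorem exists_intervalBound_root {ψ : ℝ → H} {θ L nbar : ℝ} (hfin : arcLength ψ 1 ≠ ⊤)
    (hθ : 0 < θ) (hv : BddAbove (speeds ψ θ)) (hL : L = (arcLength ψ 1).toReal)
    (hnbar : nbar = 40 * L * (Real.logb 2 (vMax ψ θ / vAvg ψ) + 3) / θ + 10) :
    ∃ g, IntervalBound (fun s => (arcLength ψ s).toReal) θ 0 1 g ∧ 0 ≤ nbar ∧
      g ≤ (14 / 13) ^ nbar := by
  have hL0 : 0 ≤ L := hL ▸ ENNReal.toReal_nonneg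
  have h0 : (arcLength ψ 0).toReal = 0 := by rw [arcLength_zero, ENNReal.toReal_zero]
  have havg : vAvg ψ = L := by rw [vAvg, h0, hL]; ring
  obtain ⟨k, hk⟩ := pow_unbounded_of_one_lt (vMax ψ θ * (1 - 0) / θ) (one_lt_two (α := ℝ))
  obtain ⟨N, hI, hN0, hN⟩ := exists_intervalBound hθ (monotoneOn_toReal_arcLength hfin)
    (fun a b ha hab hb h => sub_le_vMax_mul hfin hv ha hab hb h) k le_rfl zero_lt_one le_rfl hk.le
  simp only [h0, ← hL, sub_zero, mul_one] at hN0 hN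
  have hmain : (40 * N + 10 : ℝ) ≤ nbar := by
    rw [hnbar, havg]
    rcases le_or_gt L θ with h | h
    · rw [hN0 h]
      have h1 : vMax ψ θ = L := by rw [vMax, if_pos (hL ▸ h), havg]
      -- For `L = 0` the conventions `0 / 0 = 0` and `logb 2 0 = 0` give the same value.
      have h2 : Real.logb 2 (L / L) = 0 := by
        rcases eq_or_ne L 0 with h' | h'
        · simp [h']
        · simp [div_self h']
      rw [h1, h2]
      have : 0 ≤ 40 * L * (0 + 3) / θ := by positivity
      simpa using this
    · have h1 := hN h
      rw [div_div_div_cancel_right₀ hθ.ne'] at h1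
      have h2 : 40 * L * (Real.logb 2 (vMax ψ θ / L) + 3) / θ =
          40 * (L / θ * (Real.logb 2 (vMax ψ θ / L) + 3)) := by ring
      rw [h2]
      linarith
  refine ⟨_, hI, le_trans (by positivity) hmain, (two_mul_eight_pow_le N).trans ?_⟩
  rw [← Real.rpow_natCast]
  refine Real.rpow_le_rpow_of_exponent_le (by norm_num) ?_
  push_cast
  exact hmain

end Eigenpath

end

theorem mainTheorem2 {H : Type*} [NormedAddCommGroup H] [InnerProductSpace ℂ H]
    [FiniteDimensional ℂ H]
    (ψ : ℝ → H) (U : ℝ → H ≃ₗᵢ[ℂ] H) (φ φest : ℝ → Real.Angle) (Δ : ℝ) (hΔ : 0 < Δ)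
    (hψ : ∀ s ∈ Set.Icc (0 : ℝ) 1, ‖ψ s‖ = 1)
    (heigen : ∀ s ∈ Set.Icc (0 : ℝ) 1, Eigenpath.HasPhase (U s) (φ s) (ψ s))
    (hnondeg : ∀ s ∈ Set.Icc (0 : ℝ) 1, ∀ v : H, Eigenpath.HasPhase (U s) (φ s) v →
      ∃ c : ℂ, v = c • ψ s)
    (hgap : ∀ s ∈ Set.Icc (0 : ℝ) 1, ∀ (μ : Real.Angle) (v : H), v ≠ 0 →
      Eigenpath.HasPhase (U s) μ v → μ ≠ φ s → Δ ≤ ‖μ - φ s‖)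
    (hest : ∀ s ∈ Set.Icc (0 : ℝ) 1, ‖φest s - φ s‖ ≤ Δ / 4)
    (R : ℝ → H →ₗᵢ[ℂ] H)
    (hR : ∀ s ∈ Set.Icc (0 : ℝ) 1, Eigenpath.IsReflectionOracle (U s) (φest s) Δ (R s))
    (θ L nbar : ℝ) (hθ : θ = Real.arccos √(1 / 3))
    (hfin : Eigenpath.arcLength ψ 1 ≠ ⊤) (hL : L = (Eigenpath.arcLength ψ 1).toReal)
    (hv : BddAbove (Eigenpath.speeds ψ θ))
    (hnbar : nbar =
      40 * L * (Real.logb 2 (Eigenpath.vMax ψ θ / Eigenpath.vAvg ψ) + 3) / θ + 10) :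
    (∀ h y, Eigenpath.treeTraversal.run R (ψ 0) h = some y →
      ∃ a : Eigenpath.Anc → ℂ, y.vec = fun i => a i • ψ 1) ∧
    Eigenpath.treeTraversal.expect R (ψ 0) (fun _ => 1) = 1 ∧
    Eigenpath.treeTraversal.expect R (ψ 0) (fun n => (n : ENNReal)) ≤ ENNReal.ofReal nbar ∧
    ∀ Γ : ℝ, 1 ≤ Γ → Γ ≤ 14 / 13 →
      Eigenpath.treeTraversal.expect R (ψ 0) (fun n => ENNReal.ofReal (Γ ^ n)) ≤
        ENNReal.ofReal (Γ ^ (36 * nbar)) := by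
  have hθ0 : 0 < θ := by
    rw [hθ, Real.arccos_pos, Real.sqrt_lt' one_pos]
    norm_num
  have hpath : Eigenpath.IsReflectionPath R ψ (fun s => (Eigenpath.arcLength ψ s).toReal) θ :=
    { reflect := fun s hs => (hR s hs).apply_eq (hψ s hs) (heigen s hs) (hnondeg s hs) (hgap s hs)
        (hest s hs)
      norm_eq := hψ
      mono := Eigenpath.monotoneOn_toReal_arcLength hfin
      overlap_ge := fun a b ha hab hb h =>
        Eigenpath.overlap_ge_of_sub_le hfin hψ ha hab hb (hθ ▸ h) }
  obtain ⟨g, hg, hg0, hgn⟩ := Eigenpath.exists_intervalBound_root hfin hθ0 hv hL hnbar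
  have hsup := Eigenpath.isSupersolution_reach hpath
  have hstart : Eigenpath.Reach ψ (fun s => (Eigenpath.arcLength ψ s).toReal) θ
      ⟨Eigenpath.treeTraversal.start, Eigenpath.withAncillas (ψ 0), 0⟩ 1 g := by
    have h := (Eigenpath.PathBound.cons _ _ _ _ _ hg .nil).reach hpath 1 0
    rw [one_smul, norm_one, one_pow, pow_zero, one_mul, one_mul, mul_one,
      ← Eigenpath.withAncillas_eq] at h
    exact h
  have hone := hsup.expect_one_eq (by norm_num) hstart
  have hgen : Eigenpath.treeTraversal.expect R (ψ 0) (fun n => ENNReal.ofReal ((14 / 13) ^ n)) ≤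
      ENNReal.ofReal ((14 / 13) ^ nbar) :=
    (hsup.expect_pow_le (by norm_num) hstart).trans (ENNReal.ofReal_le_ofReal hgn)
  refine ⟨fun h y hy => ?_, hone, ?_, fun Γ hΓ hΓ₀ => ?_⟩
  · obtain ⟨⟨w, v, hwv⟩, hn⟩ := Eigenpath.Procedure.runFrom_induction
      (p := fun x => ∃ w v, Eigenpath.Reach ψ (fun s => (Eigenpath.arcLength ψ s).toReal) θ x w v)
      (fun x c k ⟨w, v, hx⟩ hn o => by
        obtain ⟨w', v', -, -, h3⟩ := hsup.step hx hn
        exact ⟨_, _, (h3 o).1⟩) h ⟨_, _, hstart⟩ hy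
    cases hwv with
    | halted z n v hz =>
      refine ⟨fun i => if i = (0, 0) then z else 0, ?_⟩
      rw [← Eigenpath.withAncillas_eq]
      ext i
      simp [Eigenpath.withAncillas]
    | running => simp [Eigenpath.treeTraversal] at hn
  · exact Eigenpath.Procedure.expect_natCast_le hone (by norm_num) hg0 hgen
  · refine (Eigenpath.Procedure.expect_pow_le_rpow hone hΓ hΓ₀ (by norm_num) hgen).trans
      (ENNReal.ofReal_le_ofReal ?_)
    -- The exponent `nbar` already suffices; `nbar ≥ 0` makes `36 * nbar` a weakening.
    exact Real.rpow_le_rpow_of_exponent_le hΓ (by linarith)
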